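/- Orient $S^3$ as the boundary of the unit ball of $\mathbb R^4$. An oriented link $L\subset S^3$ is an oriented smooth submanifold that is a disjoint union of finitely many circles. Two oriented links have the same oriented link type if an orientation preserving diffeomorphism of $S^3$ carries one to the other, respecting their orientations (in particular, if they are ambient isotopic as oriented links). Given an oriented link $L$, choose a regular neighbourhood $N_L$, i.e. a closed tubular neighbourhood, and put $E_L=\overline{S^3\setminus N_L}$; choose an embedded 3-ball $B^3\subset S^3$ with $N_L\subset B^3$ and two antipodal points $z_0,z_1$ of $\partial B^3$. For $p\in\partial N_L$ let $m_p$ be the meridian loop in $\partial N_L$ based at $p$, going once around $L$ in the direction given by the right-hand rule. Let $\mathcal B_L$ be the set of pairs $(a_0,a_1)$, where $a_i$ is a path in $E_L$ from a point of $\partial N_L$ to $z_i$ and $a_0(0)=a_1(0)$. Write $(a_0,a_1)\sim(b_0,b_1)$ if there is a homotopy $H_t\colon[0,1]\to E_L$ from $\overline{a_0}\cdot a_1$ to $\overline{b_0}\cdot b_1$ with $H_t(0)=z_0$, $H_t(1)=z_1$ and $H_t(\tfrac12)\in\partial N_L$ for all $t$. With $p_i(a_0,a_1)=\overline{a_i}\cdot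 m_{a_i(0)}\cdot a_i$, the topological biquandle of $L$ is the set $\widehat{\mathcal B}_L=\mathcal B_L/{\sim}$ with the operations $$[a_0,a_1]^{[b_0,b_1]}=[a_0\cdot p_0(b_0,b_1),\,a_1],\qquad [a_0,a_1]_{[b_0,b_1]}=[a_0,\,a_1\cdot p_1(b_0,b_1)].$$ Corollary (the topological biquandle is a link invariant). Let $L$ and $L'$ be oriented links of the same oriented link type. Then the topological biquandle of $L$, constructed with any choice of neighbourhood, ball and antipodal basepoints, and the topological biquandle of $L'$, constructed with any such choices, are isomorphic as biquandles. In particular, up to isomorphism the topological biquandle of $L$ does not depend on these choices. -/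

import Mathlib

open Set
open scoped Manifold ContDiff unitInterval

noncomputable section

/-! ### Biquandles -/

/-- A biquandle: `up a b` is `a^b` and `down a b` is `a_b`. -/
class Biquandle (B : Type*) where
  up : B → B → B
  down : B → B → B
  up_bijective : ∀ a, Function.Bijective fun x => up x a
  down_bijective : ∀ a, Function.Bijective fun x => down x a
  switch_bijective : Function.Bijective fun p : B × B => (down p.2 p.1, up p.1 p.2)
  /-- `f_a⁻¹(a) = a_{f_a⁻¹(a)}` where `f_a(x) = x^a` -/
  up_inv_self : ∀ a x, up x a = a → x = down a x
  /-- `g_a⁻¹(a) = a^{g_a⁻¹(a)}` where `g_a(x) = x_a` -/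
  down_inv_self : ∀ a x, down x a = a → x = up a x
  up_interchange : ∀ a b c, up (up a b) c = up (up a (down c b)) (up b c)
  rule_of_five : ∀ a b c,
    up (down a b) (down c (up b a)) = down (up a c) (up b (down c a))
  down_interchange : ∀ a b c, down (down a b) c = down (down a (up c b)) (down b c)

/-- An isomorphism of biquandles: a bijection that respects both operations. -/
structure BiquandleIso (B C : Type*) [Biquandle B] [Biquandle C] extends B ≃ C where
  map_up : ∀ a b, toFun (Biquandle.up a b) = Biquandle.up (toFun a) (toFun b)
  map_down : ∀ a b, toFun (Biquandle.down a b) = Biquandle.down (toFun a) (toFun b)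

/-! ### The biquandle of path pairs -/

/-- The space `X` (playing the role of the exterior `E_L`) with the part `bdry` of its boundary
(playing the role of `∂N_L`), a continuous family of loops `mer p`, based at `p`, in `bdry`
(the meridians) and two basepoints. -/
structure PeripheralSystem (X : Type*) [TopologicalSpace X] where
  bdry : Set X
  mer : ∀ p : bdry, Path p p
  mer_continuous : Continuous fun q : bdry × I => mer q.1 q.2
  z₀ : X
  z₁ : X

/-- The midpoint of the unit interval. -/
def midpt : I := ⟨1 / 2, by norm_num, by norm_num⟩

namespace PeripheralSystem

variable {X : Type*} [TopologicalSpace X] (P : PeripheralSystem X)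

/-- A pair of paths `a₀`, `a₁` from a common point of `bdry` to `z₀` and `z₁`. -/
structure PathPair where
  base : P.bdry
  fst : Path (base : X) P.z₀
  snd : Path (base : X) P.z₁

variable {P}

/-- Two pairs are equivalent if the paths `ā₀ · a₁` and `b̄₀ · b₁` are homotopic through paths from
`z₀` to `z₁` that are in `bdry` at time `1/2`. -/
def PathPair.Rel (a b : P.PathPair) : Prop :=
  ContinuousMap.HomotopicWith
    (a.fst.symm.trans a.snd : C(I, X)) (b.fst.symm.trans b.snd : C(I, X))
    (fun h => h 0 = P.z₀ ∧ h 1 = P.z₁ ∧ h midpt ∈ P.bdry)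

/-- The meridian loop at a point of `bdry`, as a loop in `X`. -/
def meridian (P : PeripheralSystem X) (p : P.bdry) : Path (p : X) (p : X) :=
  (P.mer p).map continuous_subtype_val

/-- The loop `ā₀ · m · a₀` at `z₀`, representing `p₀(a₀, a₁)`. -/
def PathPair.loop₀ (a : P.PathPair) : Path P.z₀ P.z₀ :=
  (a.fst.symm.trans (P.meridian a.base)).trans a.fst

/-- The loop `ā₁ · m · a₁` at `z₁`, representing `p₁(a₀, a₁)`. -/
def PathPair.loop₁ (a : P.PathPair) : Path P.z₁ P.z₁ :=
  (a.snd.symm.trans (P.meridian a.base)).trans a.snd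

/-- `(a₀, a₁)^(b₀, b₁) = (a₀ · p₀(b₀, b₁), a₁)` -/
def PathPair.up (a b : P.PathPair) : P.PathPair :=
  ⟨a.base, a.fst.trans b.loop₀, a.snd⟩

/-- `(a₀, a₁)_(b₀, b₁) = (a₀, a₁ · p₁(b₀, b₁))` -/
def PathPair.down (a b : P.PathPair) : P.PathPair :=
  ⟨a.base, a.fst, a.snd.trans b.loop₁⟩

/-! Facts needed for the operations on equivalence classes to be well defined. -/

theorem square {x y z w : X} (K : C(I × I, X)) (a : Path x y) (b : Path z w) (g : Path x z)
    (d : Path y w) (ha : ∀ s, K (0, s) = a s) (hb : ∀ s, K (1, s) = b s)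
    (hg : ∀ t, K (t, 0) = g t) (hd : ∀ t, K (t, 1) = d t) :
    (a.trans d).Homotopic (g.trans b) := by
  obtain rfl : K (0, 0) = x := by rw [ha, a.source]
  obtain rfl : K (0, 1) = y := by rw [ha, a.target]
  obtain rfl : K (1, 0) = z := by rw [hb, b.source]
  obtain rfl : K (1, 1) = w := by rw [hb, b.target]
  let f : C(I, X) := ⟨fun s => K (0, s), by fun_prop⟩
  let g' : C(I, X) := ⟨fun s => K (1, s), by fun_prop⟩
  let F : f.Homotopy g' := ⟨K, fun _ => rfl, fun _ => rfl⟩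
  let p : Path (0 : I) 1 := ⟨⟨id, continuous_id⟩, rfl, rfl⟩
  have h := Path.Homotopic.map_trans_evalAt F p
  have e1 : p.map (map_continuous f) = a := by ext s; exact ha s
  have e2 : p.map (map_continuous g') = b := by ext s; exact hb s
  have e3 : F.evalAt 0 = g := by ext s; exact hg s
  have e4 : F.evalAt 1 = d := by ext s; exact hd s
  rw [e1, e2, e3, e4] at h
  exact h

namespace PathPair

theorem mid (a : P.PathPair) : (a.fst.symm.trans a.snd) midpt = a.base := by
  rw [Path.trans_apply, dif_pos (by simp [midpt])]
  have : (⟨2 * (midpt : ℝ), (unitInterval.mul_pos_mem_iff zero_lt_two).2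
    ⟨midpt.2.1, by simp [midpt]⟩⟩ : I) = 1 := Subtype.ext (by simp [midpt])
  rw [this]; simp

theorem good (a : P.PathPair) :
    (a.fst.symm.trans a.snd : C(I, X)) 0 = P.z₀ ∧ (a.fst.symm.trans a.snd : C(I, X)) 1 = P.z₁ ∧
      (a.fst.symm.trans a.snd : C(I, X)) midpt ∈ P.bdry := by
  refine ⟨by simp, by simp, ?_⟩
  change (a.fst.symm.trans a.snd) midpt ∈ P.bdry
  rw [a.mid]; exact a.base.2

theorem Rel.refl (a : P.PathPair) : Rel a a := ContinuousMap.HomotopicWith.refl _ a.good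

theorem Rel.symm {a b : P.PathPair} (h : Rel a b) : Rel b a := ContinuousMap.HomotopicWith.symm h

theorem Rel.trans {a b c : P.PathPair} (h : Rel a b) (h' : Rel b c) : Rel a c :=
  ContinuousMap.HomotopicWith.trans h h'

/-- A path in `bdry`, as a path in `X`. -/
def incl {p q : P.bdry} (γ : Path p q) : Path (p : X) (q : X) := γ.map continuous_subtype_val

theorem Rel.exists_path {a b : P.PathPair} (h : Rel a b) :
    ∃ γ : Path a.base b.base, a.fst.Homotopic ((incl γ).trans b.fst) ∧
      a.snd.Homotopic ((incl γ).trans b.snd) := by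
  obtain ⟨H⟩ := h
  have hP : ∀ t : I, H (t, 0) = P.z₀ ∧ H (t, 1) = P.z₁ ∧ H (t, midpt) ∈ P.bdry := H.prop'
  have h0 : ∀ s : I, H (0, s) = (a.fst.symm.trans a.snd) s := H.apply_zero
  have h1 : ∀ s : I, H (1, s) = (b.fst.symm.trans b.snd) s := H.apply_one
  have hc : Continuous H := H.continuous
  let γ : Path a.base b.base :=
    { toFun := fun t => ⟨H (t, midpt), (hP t).2.2⟩
      continuous_toFun := by fun_prop
      source' := Subtype.ext ((h0 _).trans a.mid)
      target' := Subtype.ext ((h1 _).trans b.mid) }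
  -- the two halves of the parameter interval
  let l : I → I := fun s => ⟨(1 - s) / 2, by constructor <;> linarith [s.2.1, s.2.2]⟩
  let r : I → I := fun s => ⟨(1 + s) / 2, by constructor <;> linarith [s.2.1, s.2.2]⟩
  have hl : Continuous l := by fun_prop
  have hr : Continuous r := by fun_prop
  have vl : ∀ (c : P.PathPair) (s : I), (c.fst.symm.trans c.snd) (l s) = c.fst s := by
    intro c s
    rw [Path.trans_apply, dif_pos (by simp only [l]; linarith [s.2.1])]
    change c.fst _ = c.fst s
    congr 1
    exact Subtype.ext (show 1 - 2 * ((1 - (s : ℝ)) / 2) = s by ring)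
  have vr : ∀ (c : P.PathPair) (s : I), (c.fst.symm.trans c.snd) (r s) = c.snd s := by
    intro c s
    rcases eq_or_ne s 0 with rfl | hs
    · have : r 0 = midpt := Subtype.ext (by simp [r, midpt])
      rw [this, c.mid]; simp
    have : 0 < (s : ℝ) := unitInterval.pos_iff_ne_zero.2 hs
    rw [Path.trans_apply, dif_neg (by simp only [r]; linarith)]
    congr 1
    exact Subtype.ext (by simp [r]; ring)
  have l0 : l 0 = midpt := Subtype.ext (by simp [l, midpt])
  have r0 : r 0 = midpt := Subtype.ext (by simp [r, midpt])
  have l1 : l 1 = 0 := Subtype.ext (by simp [l])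
  have r1 : r 1 = 1 := Subtype.ext (by simp [r])
  refine ⟨γ, ?_, ?_⟩
  · have := square (⟨fun q => H (q.1, l q.2), by fun_prop⟩ : C(I × I, X)) a.fst b.fst (incl γ)
      (Path.refl _) (fun s => (h0 _).trans (vl a s)) (fun s => (h1 _).trans (vl b s))
      (fun t => by simp [l0, incl, γ]) (fun t => by simp [l1, (hP t).1])
    exact (Path.Homotopic.trans_refl _).symm.trans this
  · have := square (⟨fun q => H (q.1, r q.2), by fun_prop⟩ : C(I × I, X)) a.snd b.snd (incl γ)
      (Path.refl _) (fun s => (h0 _).trans (vr a s)) (fun s => (h1 _).trans (vr b s))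
      (fun t => by simp [r0, incl, γ]) (fun t => by simp [r1, (hP t).2.1])
    exact (Path.Homotopic.trans_refl _).symm.trans this

theorem rel_of_homotopic {p : P.bdry} {a₀ b₀ : Path (p : X) P.z₀} {a₁ b₁ : Path (p : X) P.z₁}
    (h₀ : a₀.Homotopic b₀) (h₁ : a₁.Homotopic b₁) :
    Rel (⟨p, a₀, a₁⟩ : P.PathPair) ⟨p, b₀, b₁⟩ := by
  obtain ⟨H₀⟩ := h₀
  obtain ⟨H₁⟩ := h₁
  let K := H₀.symm₂.hcomp H₁
  refine ⟨⟨K.toHomotopy, fun t => ?_⟩⟩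
  have e : K (t, midpt) = p := Path.Homotopy.hcomp_half _ _ _
  refine ⟨K.source t, K.target t, ?_⟩
  change K (t, midpt) ∈ _
  rw [e]; exact p.2

theorem trans_congr {x x' y y' z z' : X} (a : Path x y) (a' : Path x' y') (b : Path y z)
    (b' : Path y' z') (ha : ∀ s, a s = a' s) (hb : ∀ s, b s = b' s) (s : I) :
    (a.trans b) s = (a'.trans b') s := by
  simp only [Path.trans_apply, ha, hb]

theorem symm_trans_congr {x x' y y' z z' : X} (a : Path x y) (a' : Path x' y') (b : Path x z)
    (b' : Path x' z') (ha : ∀ s, a s = a' s) (hb : ∀ s, b s = b' s) (s : I) :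
    (a.symm.trans b) s = (a'.symm.trans b') s := by
  exact trans_congr _ _ _ _ (fun s => ha (σ s)) hb s

/-- The part of a path from time `t` on. -/
def tail {x y : X} (γ : Path x y) (t : I) : Path (γ t) y :=
  (γ.subpath t 1).cast rfl γ.target.symm

theorem tail_continuous {x y : X} (γ : Path x y) : Continuous ↿(tail γ) := by
  exact γ.subpath_continuous_family.comp
    (f := fun q : I × I => (q.1, (1 : I), q.2)) (by fun_prop)

theorem rel_slide {p q : P.bdry} (γ : Path p q) (b₀ : Path (q : X) P.z₀) (b₁ : Path (q : X) P.z₁) :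
    Rel (⟨p, (incl γ).trans b₀, (incl γ).trans b₁⟩ : P.PathPair) ⟨q, b₀, b₁⟩ := by
  have h2 : Rel (⟨q, (Path.refl _).trans b₀, (Path.refl _).trans b₁⟩ : P.PathPair) ⟨q, b₀, b₁⟩ :=
    rel_of_homotopic (Path.Homotopic.refl_trans _) (Path.Homotopic.refl_trans _)
  refine Rel.trans ?_ h2
  let A : ∀ t : I, P.PathPair := fun t => ⟨γ t, (tail (incl γ) t).trans b₀, (tail (incl γ) t).trans b₁⟩
  have hc0 : Continuous ↿(fun t => (tail (incl γ) t).trans b₀) :=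
    Path.trans_continuous_family _ (tail_continuous _) _ (by
      exact b₀.continuous.comp continuous_snd)
  have hc1 : Continuous ↿(fun t => (tail (incl γ) t).trans b₁) :=
    Path.trans_continuous_family _ (tail_continuous _) _ (by
      exact b₁.continuous.comp continuous_snd)
  have hc : Continuous ↿(fun t => (A t).fst.symm.trans (A t).snd) :=
    Path.trans_continuous_family _ (Path.symm_continuous_family _ hc0) _ hc1
  refine ⟨⟨⟨⟨fun x => ((A x.1).fst.symm.trans (A x.1).snd) x.2, hc⟩, ?_, ?_⟩, fun t => (A t).good⟩⟩
  · intro s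
    refine symm_trans_congr _ _ _ _ (fun s => ?_) (fun s => ?_) s
    all_goals exact trans_congr _ _ _ _ (fun s => by simp [tail]) (fun _ => rfl) s
  · intro s
    refine symm_trans_congr _ _ _ _ (fun s => ?_) (fun s => ?_) s
    all_goals exact trans_congr _ _ _ _ (fun s => by simp [tail]) (fun _ => rfl) s

theorem rel_iff {a b : P.PathPair} : Rel a b ↔
    ∃ γ : Path a.base b.base, a.fst.Homotopic ((incl γ).trans b.fst) ∧
      a.snd.Homotopic ((incl γ).trans b.snd) := by
  refine ⟨Rel.exists_path, ?_⟩
  rintro ⟨γ, h₀, h₁⟩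
  exact (rel_of_homotopic h₀ h₁).trans (rel_slide γ b.fst b.snd)

/-- Meridians at the two ends of a path in `bdry` are conjugate along the path. -/
theorem meridian_conj {p q : P.bdry} (γ : Path p q) :
    ((P.meridian p).trans (incl γ)).Homotopic ((incl γ).trans (P.meridian q)) := by
  have hc := P.mer_continuous
  refine square ⟨fun x => (P.mer (γ x.1) x.2 : X), ?_⟩ _ _ _ _ ?_ ?_ ?_ ?_
  · exact continuous_subtype_val.comp
      (hc.comp (f := fun x : I × I => (γ x.1, x.2)) (by fun_prop))
  · intro s
    change ((P.mer (γ 0) s : P.bdry) : X) = P.mer p s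
    rw [γ.source]
  · intro s
    change ((P.mer (γ 1) s : P.bdry) : X) = P.mer q s
    rw [γ.target]
  all_goals intro s; simp [incl]

open Path.Homotopic (Quotient)

theorem cancel₁ {x y z : X} (g : Quotient x y) (h : Quotient y z) :
    g.symm.trans (g.trans h) = h := by
  rw [← Path.Homotopic.Quotient.trans_assoc]; simp

theorem cancel₂ {x y z : X} (g : Quotient y x) (h : Quotient y z) :
    g.trans (g.symm.trans h) = h := by
  rw [← Path.Homotopic.Quotient.trans_assoc]; simp

theorem symm_trans_rev {x y z : X} (g : Quotient x y) (h : Quotient y z) :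
    (g.trans h).symm = h.symm.trans g.symm := by
  have := cancel₁ (g.trans h) (h.symm.trans g.symm)
  rw [Path.Homotopic.Quotient.trans_assoc, cancel₂, Path.Homotopic.Quotient.trans_symm,
    Path.Homotopic.Quotient.trans_refl] at this
  exact this

theorem symm_symm' {x y : X} (g : Quotient x y) : g.symm.symm = g := by
  have := cancel₁ g.symm g
  rwa [Path.Homotopic.Quotient.symm_trans, Path.Homotopic.Quotient.trans_refl] at this

theorem symm_refl' (x : X) : (Path.Homotopic.Quotient.refl x).symm = .refl x := by
  have := Path.Homotopic.Quotient.symm_trans (.refl x)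
  rwa [Path.Homotopic.Quotient.trans_refl] at this

theorem loop_aux {p q : P.bdry} (γ : Path p q) {z : X} {a : Path (p : X) z} {b : Path (q : X) z}
    (h : a.Homotopic ((incl γ).trans b)) :
    ((a.symm.trans (P.meridian p)).trans a).Homotopic
      ((b.symm.trans (P.meridian q)).trans b) := by
  have h1 := Path.Homotopic.Quotient.eq.2 h
  have h2 := Path.Homotopic.Quotient.eq.2 (meridian_conj γ)
  rw [← Path.Homotopic.Quotient.eq]
  simp only [Path.Homotopic.Quotient.mk_trans, Path.Homotopic.Quotient.mk_symm] at *
  rw [h1, symm_trans_rev]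
  simp only [Path.Homotopic.Quotient.trans_assoc]
  rw [← Path.Homotopic.Quotient.trans_assoc (Path.Homotopic.Quotient.mk (P.meridian p)), h2]
  simp only [Path.Homotopic.Quotient.trans_assoc, cancel₁]

theorem Rel.loop₀ {a b : P.PathPair} (h : Rel a b) : a.loop₀.Homotopic b.loop₀ := by
  obtain ⟨γ, h, -⟩ := h.exists_path
  exact loop_aux γ h

theorem Rel.loop₁ {a b : P.PathPair} (h : Rel a b) : a.loop₁.Homotopic b.loop₁ := by
  obtain ⟨γ, -, h⟩ := h.exists_path
  exact loop_aux γ h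

/-- Append a loop at `z₀` to the first path and a loop at `z₁` to the second one. -/
def act (a : P.PathPair) (g : Path P.z₀ P.z₀) (h : Path P.z₁ P.z₁) : P.PathPair :=
  ⟨a.base, a.fst.trans g, a.snd.trans h⟩

theorem Rel.act {a b : P.PathPair} (r : Rel a b) {g g' : Path P.z₀ P.z₀} {h h' : Path P.z₁ P.z₁}
    (hg : g.Homotopic g') (hh : h.Homotopic h') : Rel (a.act g h) (b.act g' h') := by
  obtain ⟨γ, h₀, h₁⟩ := r.exists_path
  exact rel_iff.2 ⟨γ, (h₀.hcomp hg).trans (Path.Homotopic.trans_assoc _ _ _),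
    (h₁.hcomp hh).trans (Path.Homotopic.trans_assoc _ _ _)⟩

theorem up_rel_act (a b : P.PathPair) : Rel (a.up b) (a.act b.loop₀ (Path.refl _)) :=
  rel_of_homotopic (Path.Homotopic.refl _) (Path.Homotopic.trans_refl _).symm

theorem down_rel_act (a b : P.PathPair) : Rel (a.down b) (a.act (Path.refl _) b.loop₁) :=
  rel_of_homotopic (Path.Homotopic.trans_refl _).symm (Path.Homotopic.refl _)

theorem Rel.up {a b c d : P.PathPair} (h : Rel a c) (h' : Rel b d) : Rel (a.up b) (c.up d) :=
  ((up_rel_act a b).trans (h.act h'.loop₀ (Path.Homotopic.refl _))).trans (up_rel_act c d).symm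

theorem Rel.down {a b c d : P.PathPair} (h : Rel a c) (h' : Rel b d) :
    Rel (a.down b) (c.down d) :=
  ((down_rel_act a b).trans (h.act (Path.Homotopic.refl _) h'.loop₁)).trans
    (down_rel_act c d).symm

end PathPair

variable (P)

/-- Equivalence of path pairs, as a setoid. -/
def pairSetoid : Setoid P.PathPair :=
  ⟨PathPair.Rel, ⟨PathPair.Rel.refl, PathPair.Rel.symm, PathPair.Rel.trans⟩⟩

/-- The set of equivalence classes `[a₀, a₁]` of path pairs. -/
def Classes : Type _ := Quotient P.pairSetoid

namespace Classes

variable {P}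

/-- `[a₀, a₁]^[b₀, b₁] = [a₀ · p₀(b₀, b₁), a₁]` -/
def up : P.Classes → P.Classes → P.Classes :=
  Quotient.map₂ PathPair.up fun _ _ h _ _ h' => PathPair.Rel.up h h'

/-- `[a₀, a₁]_[b₀, b₁] = [a₀, a₁ · p₁(b₀, b₁)]` -/
def down : P.Classes → P.Classes → P.Classes :=
  Quotient.map₂ PathPair.down fun _ _ h _ _ h' => PathPair.Rel.down h h'

/-! Facts needed for the biquandle axioms: the two operations are given by right actions of the
two fundamental groups. -/

/-- The class of `ā₀ · m · a₀`. -/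
def lp₀ : P.Classes → Path.Homotopic.Quotient P.z₀ P.z₀ :=
  Quotient.lift (fun a => Path.Homotopic.Quotient.mk a.loop₀)
    fun _ _ h => Path.Homotopic.Quotient.eq.2 (PathPair.Rel.loop₀ h)

/-- The class of `ā₁ · m · a₁`. -/
def lp₁ : P.Classes → Path.Homotopic.Quotient P.z₁ P.z₁ :=
  Quotient.lift (fun a => Path.Homotopic.Quotient.mk a.loop₁)
    fun _ _ h => Path.Homotopic.Quotient.eq.2 (PathPair.Rel.loop₁ h)

/-- The right action of the two fundamental groups. -/
def act (a : P.Classes) (g : Path.Homotopic.Quotient P.z₀ P.z₀)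
    (h : Path.Homotopic.Quotient P.z₁ P.z₁) : P.Classes :=
  Quotient.liftOn a
    (fun a => Quotient.liftOn₂ g h (fun g h => (Quotient.mk P.pairSetoid (a.act g h) : P.Classes))
      fun _ _ _ _ hg hh => Quotient.sound ((PathPair.Rel.refl a).act hg hh))
    fun a b r => by
      induction g using Quotient.inductionOn
      induction h using Quotient.inductionOn
      exact Quotient.sound (PathPair.Rel.act r (Path.Homotopic.refl _) (Path.Homotopic.refl _))


theorem up_eq (a b : P.Classes) : up a b = act a (lp₀ b) (.refl _) := by
  induction a using Quotient.inductionOn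
  induction b using Quotient.inductionOn
  exact Quotient.sound (PathPair.up_rel_act _ _)

theorem down_eq (a b : P.Classes) : down a b = act a (.refl _) (lp₁ b) := by
  induction a using Quotient.inductionOn
  induction b using Quotient.inductionOn
  exact Quotient.sound (PathPair.down_rel_act _ _)

theorem act_act (a : P.Classes) (g g' h h') :
    act (act a g h) g' h' = act a (g.trans g') (h.trans h') := by
  induction a using Quotient.inductionOn
  induction g using Quotient.inductionOn
  induction g' using Quotient.inductionOn
  induction h using Quotient.inductionOn
  induction h' using Quotient.inductionOn
  exact Quotient.sound (PathPair.rel_of_homotopic (Path.Homotopic.trans_assoc _ _ _)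
    (Path.Homotopic.trans_assoc _ _ _))

theorem act_refl (a : P.Classes) : act a (.refl _) (.refl _) = a := by
  induction a using Quotient.inductionOn
  exact Quotient.sound (PathPair.rel_of_homotopic (Path.Homotopic.trans_refl _)
    (Path.Homotopic.trans_refl _))

theorem lp₀_act (a : P.Classes) (g h) :
    lp₀ (act a g h) = (g.symm.trans (lp₀ a)).trans g := by
  induction a using Quotient.inductionOn
  induction g using Quotient.inductionOn
  induction h using Quotient.inductionOn
  rename_i a g h
  change Path.Homotopic.Quotient.mk (PathPair.loop₀ (a.act g h)) = ((Path.Homotopic.Quotient.mk g).symm.trans (Path.Homotopic.Quotient.mk a.loop₀)).trans (Path.Homotopic.Quotient.mk g)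
  simp [PathPair.loop₀, PathPair.act]

theorem lp₁_act (a : P.Classes) (g h) :
    lp₁ (act a g h) = (h.symm.trans (lp₁ a)).trans h := by
  induction a using Quotient.inductionOn
  induction g using Quotient.inductionOn
  induction h using Quotient.inductionOn
  rename_i a g h
  change Path.Homotopic.Quotient.mk (PathPair.loop₁ (a.act g h)) = ((Path.Homotopic.Quotient.mk h).symm.trans (Path.Homotopic.Quotient.mk a.loop₁)).trans (Path.Homotopic.Quotient.mk h)
  simp [PathPair.loop₁, PathPair.act]

theorem act_self (a : P.Classes) : act a (lp₀ a) (lp₁ a) = a := by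
  induction a using Quotient.inductionOn
  rename_i a
  refine Quotient.sound (PathPair.rel_iff.2 ⟨P.mer a.base, ?_, ?_⟩)
  · rw [← Path.Homotopic.Quotient.eq]
    change Path.Homotopic.Quotient.mk (a.fst.trans a.loop₀) = Path.Homotopic.Quotient.mk ((P.meridian a.base).trans a.fst)
    simp [PathPair.loop₀, PathPair.cancel₂]
  · rw [← Path.Homotopic.Quotient.eq]
    change Path.Homotopic.Quotient.mk (a.snd.trans a.loop₁) = Path.Homotopic.Quotient.mk ((P.meridian a.base).trans a.snd)
    simp [PathPair.loop₁, PathPair.cancel₂]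

/-- The classes of path pairs form a biquandle. -/
instance : Biquandle P.Classes where
  up := up
  down := down
  up_bijective a := by
    refine Function.bijective_iff_has_inverse.2
      ⟨fun x => act x (lp₀ a).symm (.refl _), fun x => ?_, fun x => ?_⟩ <;>
    simp [up_eq, act_act, act_refl]
  down_bijective a := by
    refine Function.bijective_iff_has_inverse.2
      ⟨fun x => act x (.refl _) (lp₁ a).symm, fun x => ?_, fun x => ?_⟩ <;>
    simp [down_eq, act_act, act_refl]
  switch_bijective := by
    refine Function.bijective_iff_has_inverse.2
      ⟨fun p => (act p.2 (lp₀ p.1).symm (.refl _), act p.1 (.refl _) (lp₁ p.2).symm),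
        fun p => ?_, fun p => ?_⟩ <;>
    simp [up_eq, down_eq, act_act, act_refl, lp₀_act, lp₁_act, PathPair.symm_refl']
  up_inv_self a x h := by
    have hx : x = act a (lp₀ a).symm (.refl _) := by
      rw [up_eq] at h
      conv_rhs => arg 1; rw [← h]
      simp [act_act, act_refl]
    rw [hx, down_eq, lp₁_act]
    conv_lhs => rw [← act_self a]
    simp [act_act, PathPair.symm_refl', lp₀_act]
  down_inv_self a x h := by
    have hx : x = act a (.refl _) (lp₁ a).symm := by
      rw [down_eq] at h
      conv_rhs => arg 1; rw [← h]
      simp [act_act, act_refl]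
    rw [hx, up_eq, lp₀_act]
    conv_lhs => rw [← act_self a]
    simp [act_act, PathPair.symm_refl', lp₁_act]
  up_interchange a b c := by
    simp [up_eq, down_eq, act_act, lp₀_act, PathPair.symm_refl', PathPair.cancel₂]
  rule_of_five a b c := by
    simp [up_eq, down_eq, act_act, lp₀_act, lp₁_act, PathPair.symm_refl']
  down_interchange a b c := by
    simp [up_eq, down_eq, act_act, lp₁_act, PathPair.symm_refl', PathPair.cancel₂]

end Classes
end PeripheralSystem

/-! ### Oriented links in the 3-sphere -/

/-- Euclidean 4-space. -/
abbrev E4 := EuclideanSpace ℝ (Fin 4)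

/-- The 3-sphere, as the unit sphere in `ℝ⁴`, with Mathlib's smooth structure. -/
abbrev S3 := Metric.sphere (0 : E4) 1

/-- The determinant of four vectors of `ℝ⁴`. -/
def det4 (a b c d : E4) : ℝ := Matrix.det (Matrix.of fun i j : Fin 4 => (![a, b, c, d] i) j)

/-- The velocity vector of a curve `c : S¹ → S³`, at `u`, in the counterclockwise direction. -/
def velocity (c : Circle → S3) (u : Circle) : E4 :=
  deriv (fun t : ℝ => (c (u * Circle.exp t) : E4)) 0

/-- An oriented (smooth) link: `n` disjoint smoothly embedded circles in `S³`. Only the image and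
the direction in which it is traversed matter, see `SameOriented`. -/
structure OrientedLink where
  n : ℕ
  curve : Fin n → Circle → S3
  smooth : ∀ i, ContMDiff (𝓡 1) (𝓡 3) ∞ (curve i)
  injective : Function.Injective fun p : Fin n × Circle => curve p.1 p.2
  immersion : ∀ i u, velocity (curve i) u ≠ 0

/-- Two families of embedded circles have the same image, and traverse it in the same direction:
they parametrize the same oriented submanifold. -/
def SameOriented {n m : ℕ} (c : Fin n → Circle → S3) (d : Fin m → Circle → S3) : Prop :=
  (∀ i u, ∃ j w, c i u = d j w ∧ ∃ r : ℝ, 0 < r ∧ velocity (c i) u = r • velocity (d j) w) ∧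
    ∀ j w, ∃ i u, c i u = d j w

/-- The vector in `ℝ⁴` that corresponds to a tangent vector of `S³`. -/
def tangentToE4 (x : S3) (v : TangentSpace (𝓡 3) x) : E4 :=
  mfderiv (𝓡 3) 𝓘(ℝ, E4) (fun y : S3 => (y : E4)) x v

/-- Positively oriented frames of `S³`, oriented as the boundary of the unit ball of `ℝ⁴`
(outward normal first). -/
def IsPositiveFrame (x : S3) (v : Fin 3 → TangentSpace (𝓡 3) x) : Prop :=
  0 < det4 x (tangentToE4 x (v 0)) (tangentToE4 x (v 1)) (tangentToE4 x (v 2))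

/-- The differential of `h` sends positively oriented frames to positively oriented frames. -/
def IsOrientationPreserving (h : S3 → S3) : Prop :=
  ∀ (x : S3) (v : Fin 3 → TangentSpace (𝓡 3) x),
    IsPositiveFrame x v → IsPositiveFrame (h x) fun j => mfderiv (𝓡 3) (𝓡 3) h x (v j)

/-- Two oriented links have the same oriented link type: some orientation preserving diffeomorphism
of `S³` carries the one to the other, respecting the orientations. -/
def OrientedLink.SameType (L L' : OrientedLink) : Prop :=
  ∃ h : Diffeomorph (𝓡 3) (𝓡 3) S3 S3 ∞,
    IsOrientationPreserving h ∧ SameOriented (fun i u => h (L.curve i u)) L'.curve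

/-! ### Regular neighbourhoods, meridians and the exterior -/

/-- A parametrized tubular neighbourhood of `L`: an orientation preserving smooth embedding of
`n` copies of `S¹ × ℂ` whose core curves `z = 0` parametrize `L` with its orientation. Positivity
of the determinant says that `map i` is a local diffeomorphism for which (direction of `L`, real
direction, imaginary direction) is a positive frame of `S³`, so that the counterclockwise direction
of `ℂ` is that given by the right-hand rule. -/
structure OrientedLink.Tube (L : OrientedLink) where
  map : Fin L.n → Circle → ℂ → S3
  smooth : ∀ i, ContMDiff ((𝓡 1).prod 𝓘(ℝ, ℂ)) (𝓡 3) ∞ fun p : Circle × ℂ => map i p.1 p.2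
  injective : Function.Injective fun p : Fin L.n × Circle × ℂ => map p.1 p.2.1 p.2.2
  positive : ∀ i u z, 0 < det4 (map i u z)
    (deriv (fun t : ℝ => (map i (u * Circle.exp t) z : E4)) 0)
    (deriv (fun t : ℝ => (map i u (z + t) : E4)) 0)
    (deriv (fun t : ℝ => (map i u (z + t * Complex.I) : E4)) 0)
  core : SameOriented (fun i u => map i u 0) L.curve

namespace OrientedLink.Tube

variable {L : OrientedLink} (T : L.Tube)

/-- The regular neighbourhood `N_L`: the image of the closed unit disc bundle. -/
def nbhd : Set S3 := {x | ∃ i u z, ‖z‖ ≤ 1 ∧ T.map i u z = x}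

/-- The exterior `E_L`, the closure of the complement of `N_L`. -/
def exterior : Set S3 := closure T.nbhdᶜ

theorem continuous_map (i : Fin L.n) : Continuous fun p : Circle × ℂ => T.map i p.1 p.2 :=
  (T.smooth i).continuous

theorem map_mem_exterior (i : Fin L.n) (u w : Circle) : T.map i u w ∈ T.exterior := by
  have hc : Continuous fun r : ℝ => T.map i u (r * (w : ℂ)) :=
    (T.continuous_map i).comp (f := fun r : ℝ => (u, (r * (w : ℂ)))) (by fun_prop)
  have h1 : (1 : ℝ) ∈ closure (Ioi (1 : ℝ)) := by simp
  have h := map_mem_closure hc h1 (t := T.nbhdᶜ) (by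
    rintro r (hr : 1 < r) ⟨j, v, z, hz, e⟩
    have e' := T.injective (a₁ := (j, v, z)) (a₂ := (i, u, r * (w : ℂ))) e
    simp only [Prod.mk.injEq] at e'
    rw [e'.2.2, norm_mul, Circle.norm_coe, mul_one, Complex.norm_real] at hz
    exact absurd (le_trans (le_abs_self r) hz) (not_le.2 hr))
  simpa only [exterior, Complex.ofReal_one, one_mul] using h

/-- The parametrization of the boundary tori of the regular neighbourhood, as a map into the
exterior. -/
def torusMap (q : Fin L.n × Circle × Circle) : T.exterior :=
  ⟨T.map q.1 q.2.1 q.2.2, T.map_mem_exterior q.1 q.2.1 q.2.2⟩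

/-- The boundary `∂N_L`, as a subset of the exterior. -/
def boundary : Set T.exterior := range T.torusMap

theorem torusMap_injective : Function.Injective T.torusMap := by
  rintro ⟨i, u, w⟩ ⟨j, v, z⟩ e
  have e' := T.injective (a₁ := (i, u, (w : ℂ))) (a₂ := (j, v, (z : ℂ))) (congrArg Subtype.val e)
  simpa [Circle.ext_iff] using e'

theorem torusMap_continuous : Continuous T.torusMap := by
  refine Continuous.subtype_mk (continuous_prod_of_discrete_left.2 fun i => ?_) _
  exact (T.continuous_map i).comp
    (f := fun q : Circle × Circle => (q.1, (q.2 : ℂ))) (by fun_prop)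

/-- The boundary of the regular neighbourhood is homeomorphic to a disjoint union of tori. -/
def torusHomeo : Fin L.n × Circle × Circle ≃ₜ T.boundary :=
  Continuous.homeoOfEquivCompactToT2 (f := Equiv.ofInjective _ T.torusMap_injective)
    (T.torusMap_continuous.subtype_mk _)

/-- The meridian at a point of `∂N_L`: it runs once around the circle `map i u (unit circle)` through the
point, counterclockwise. -/
def mer (p : T.boundary) : Path p p where
  toFun t := T.torusHomeo
    ((T.torusHomeo.symm p).1, (T.torusHomeo.symm p).2.1,
      (T.torusHomeo.symm p).2.2 * Circle.exp (2 * Real.pi * t))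
  continuous_toFun := by fun_prop
  source' := by simp
  target' := by simp

theorem mer_continuous : Continuous fun q : T.boundary × I => T.mer q.1 q.2 := by
  change Continuous fun q : T.boundary × I => T.torusHomeo
    ((T.torusHomeo.symm q.1).1, (T.torusHomeo.symm q.1).2.1,
      (T.torusHomeo.symm q.1).2.2 * Circle.exp (2 * Real.pi * q.2))
  fun_prop

end OrientedLink.Tube

/-! ### The topological biquandle -/

/-- The choices in the construction of the topological biquandle of `L`: a regular neighbourhood, a
3-ball that contains it (an embedded copy of the closed unit ball of `ℝ³`, whose boundary is the
image of the unit sphere) and a pair of antipodal points of the boundary sphere. -/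
structure OrientedLink.Choices (L : OrientedLink) where
  tube : L.Tube
  ball : EuclideanSpace ℝ (Fin 3) → S3
  ball_continuous : ContinuousOn ball (Metric.closedBall 0 1)
  ball_injective : InjOn ball (Metric.closedBall 0 1)
  ball_frontier : frontier (ball '' Metric.closedBall 0 1) = ball '' Metric.sphere 0 1
  nbhd_subset : tube.nbhd ⊆ ball '' Metric.closedBall 0 1
  pole : EuclideanSpace ℝ (Fin 3)
  norm_pole : ‖pole‖ = 1

namespace OrientedLink.Choices

variable {L : OrientedLink} (D : L.Choices)

theorem mem_exterior (x : EuclideanSpace ℝ (Fin 3)) (hx : ‖x‖ = 1) :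
    D.ball x ∈ D.tube.exterior := by
  have h : D.ball x ∈ frontier (D.ball '' Metric.closedBall 0 1) := by
    rw [D.ball_frontier]; exact ⟨x, by simpa using hx, rfl⟩
  rw [frontier_eq_closure_inter_closure] at h
  exact closure_mono (compl_subset_compl.2 D.nbhd_subset) h.2

/-- The exterior with its boundary, its meridians and the two basepoints `z₀` and `z₁`. -/
def peripheralSystem : PeripheralSystem D.tube.exterior where
  bdry := D.tube.boundary
  mer := D.tube.mer
  mer_continuous := D.tube.mer_continuous
  z₀ := ⟨D.ball D.pole, D.mem_exterior _ D.norm_pole⟩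
  z₁ := ⟨D.ball (-D.pole), D.mem_exterior _ (by rw [norm_neg, D.norm_pole])⟩

end OrientedLink.Choices

/-- The topological biquandle of `L`, constructed with the choices `D`. -/
def TopologicalBiquandle (L : OrientedLink) (D : L.Choices) : Type := D.peripheralSystem.Classes

instance (L : OrientedLink) (D : L.Choices) : Biquandle (TopologicalBiquandle L D) :=
  inferInstanceAs (Biquandle D.peripheralSystem.Classes)

end

/-!
The topological biquandle does not see more of the exterior than the homotopy classes of paths in
it, so it can be computed in the link complement `S³ ∖ L`, which does not depend on any choice.

A map of peripheral systems (`PeripheralMap`), with paths that connect the images of the basepoints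
to the new basepoints, induces a homomorphism of biquandles, since both operations append conjugates
of meridians. It is an isomorphism as soon as the map is bijective on path classes, meets every path
component of the boundary part, and lifts paths in the boundary part up to homotopy
(`PeripheralMap.IsEquivalence`). This criterion is applied to maps of three kinds.

* The exterior of a tube includes in the link complement, where the boundary torus is replaced by
  the shell `0 < |z| ≤ 1` (`OrientedLink.Choices.nonempty_iso_system`). The radial push is a
  deformation retraction onto the exterior.
* An orientation preserving diffeomorphism carries a tube to a tube of the image of the link
  (`SmoothTube.comp`, `SmoothTube.nonempty_iso_of_homeomorph`).
* Two tubes with the same oriented core are compared inside the common link complement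
  (`SmoothTube.nonempty_iso_of_sameOriented`). The uniqueness of tubular neighbourhoods is not
  needed: by compactness, thin shells of one tube lie in shells of the other one and vice versa, and
  a path in a shell of one tube can be pushed along the radii of the other tube
  (`SmoothTube.nonempty_iso_of_interleaved`). The meridians agree up to homotopy
  (`SmoothTube.meridianAt_homotopic`), because the fibres of the one tube, in the coordinates of the
  other, are tangent to a real linear map `z ↦ α z + β z̄`. Its determinant is positive by the
  orientation conditions, so `|β| < |α|`, and its restriction to a circle is homotopic to `z ↦ α z`
  in the complement of the origin.

The basepoints, and hence the ball and the poles, do not matter because the link complement is path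
connected (`SmoothTube.joined_compl`): two points are joined, up to normalization, by two segments
in `ℝ⁴`, the corner of which avoids a set of dimension at most 3.
-/

noncomputable section

open Filter Topology
open scoped ComplexConjugate

/-! ### Isomorphisms of biquandles -/

namespace BiquandleIso

variable {A B C : Type*} [Biquandle A] [Biquandle B] [Biquandle C]

/-- The inverse isomorphism. -/
def symm (e : BiquandleIso A B) : BiquandleIso B A where
  toEquiv := e.toEquiv.symm
  map_up a b := by
    have h := e.map_up (e.toEquiv.symm a) (e.toEquiv.symm b)
    simp only [Equiv.toFun_as_coe, Equiv.apply_symm_apply] at h ⊢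
    rw [← h, Equiv.symm_apply_apply]
  map_down a b := by
    have h := e.map_down (e.toEquiv.symm a) (e.toEquiv.symm b)
    simp only [Equiv.toFun_as_coe, Equiv.apply_symm_apply] at h ⊢
    rw [← h, Equiv.symm_apply_apply]

/-- The composition of two isomorphisms. -/
def trans (e : BiquandleIso A B) (f : BiquandleIso B C) : BiquandleIso A C where
  toEquiv := e.toEquiv.trans f.toEquiv
  map_up a b := (congrArg f.toFun (e.map_up a b)).trans (f.map_up _ _)
  map_down a b := (congrArg f.toFun (e.map_down a b)).trans (f.map_down _ _)

end BiquandleIso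

/-! ### Maps of peripheral systems -/

variable {X Y : Type*} [TopologicalSpace X] [TopologicalSpace Y]

namespace Path.Homotopic

open PeripheralSystem.PathPair

theorem trans_right_of_homotopic {x y z w : X} {a : Path x z} {γ : Path x y} {b : Path y z}
    (h : a.Homotopic (γ.trans b)) (d : Path z w) :
    (a.trans d).Homotopic (γ.trans (b.trans d)) :=
  (h.hcomp (refl d)).trans (trans_assoc _ _ _)

/-- Transport along `d` of the right action of the loop `ā · m · a`. -/
theorem trans_conj_trans {x y z w : X} {m m' : Path y y} (h : m.Homotopic m') (c : Path x z)
    (a : Path y z) (d : Path z w) :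
    ((c.trans ((a.symm.trans m).trans a)).trans d).Homotopic
      ((c.trans d).trans (((a.trans d).symm.trans m').trans (a.trans d))) := by
  rw [← Quotient.eq] at h ⊢
  simp only [Quotient.mk_trans, Quotient.mk_symm, Quotient.trans_assoc, symm_trans_rev, h, cancel₂]

theorem homotopic_trans_of_symm_trans {x y z w : X} (γ : Path x y) (b : Path x z) (d : Path w z)
    {g : Path y w} (h : g.Homotopic ((γ.symm.trans b).trans d.symm)) :
    b.Homotopic (γ.trans (g.trans d)) := by
  rw [← Quotient.eq] at h ⊢
  simp [h, cancel₂]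

theorem of_trans_right {x y z w : X} {a : Path x z} {γ γ' : Path x y} {b : Path y z}
    {d : Path z w} (hγ : γ'.Homotopic γ) (h : (a.trans d).Homotopic (γ.trans (b.trans d))) :
    a.Homotopic (γ'.trans b) := by
  rw [← Quotient.eq] at h hγ ⊢
  simp only [Quotient.mk_trans, ← Quotient.trans_assoc] at h ⊢
  have := congrArg (fun q => q.trans (Quotient.mk d).symm) h
  simpa [hγ] using this

theorem of_trans_right_cancel {x y z : X} {a b : Path x y} {d : Path y z}
    (h : (a.trans d).Homotopic (b.trans d)) : a.Homotopic b := by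
  rw [← Quotient.eq] at h ⊢
  simp only [Quotient.mk_trans] at h
  have := congrArg (fun q => q.trans (Quotient.mk d).symm) h
  simpa using this

end Path.Homotopic

/-- A map of peripheral systems: a continuous map that sends the boundary part into the boundary
part and meridians to meridians up to homotopy. The basepoints need not be respected; instead the
image of each is joined to the basepoint of the target by a path. -/
structure PeripheralMap (P : PeripheralSystem X) (Q : PeripheralSystem Y) where
  toMap : C(X, Y)
  path₀ : Path (toMap P.z₀) Q.z₀
  path₁ : Path (toMap P.z₁) Q.z₁
  mapsTo : ∀ p : P.bdry, toMap p ∈ Q.bdry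
  meridian : ∀ p : P.bdry,
    ((P.meridian p).map toMap.continuous).Homotopic (Q.meridian ⟨toMap p, mapsTo p⟩)

namespace PeripheralMap

open PeripheralSystem PeripheralSystem.PathPair Path.Homotopic

variable {P : PeripheralSystem X} {Q : PeripheralSystem Y} (φ : PeripheralMap P Q)

/-- The image of a point of the boundary part. -/
def bdryMap (p : P.bdry) : Q.bdry := ⟨φ.toMap p, φ.mapsTo p⟩

theorem bdryMap_continuous : Continuous φ.bdryMap :=
  (φ.toMap.continuous.comp continuous_subtype_val).subtype_mk _

/-- The image of a pair of paths, prolonged to the basepoints of the target. -/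
def pairMap (a : P.PathPair) : Q.PathPair :=
  ⟨φ.bdryMap a.base, (a.fst.map φ.toMap.continuous).trans φ.path₀,
    (a.snd.map φ.toMap.continuous).trans φ.path₁⟩

theorem pairMap_rel {a b : P.PathPair} (h : Rel a b) : Rel (φ.pairMap a) (φ.pairMap b) := by
  obtain ⟨γ, h₀, h₁⟩ := h.exists_path
  have h₀' := h₀.map φ.toMap
  have h₁' := h₁.map φ.toMap
  rw [Path.map_trans] at h₀' h₁'
  exact rel_iff.2 ⟨γ.map φ.bdryMap_continuous, trans_right_of_homotopic h₀' _,
    trans_right_of_homotopic h₁' _⟩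

theorem pairMap_up (a b : P.PathPair) :
    Rel (φ.pairMap (a.up b)) ((φ.pairMap a).up (φ.pairMap b)) := by
  refine rel_of_homotopic ?_ (Path.Homotopic.refl _)
  have := trans_conj_trans (φ.meridian b.base) (a.fst.map φ.toMap.continuous)
    (b.fst.map φ.toMap.continuous) φ.path₀
  rw [Path.map_symm, ← Path.map_trans, ← Path.map_trans, ← Path.map_trans] at this
  exact this

theorem pairMap_down (a b : P.PathPair) :
    Rel (φ.pairMap (a.down b)) ((φ.pairMap a).down (φ.pairMap b)) := by
  refine rel_of_homotopic (Path.Homotopic.refl _) ?_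
  have := trans_conj_trans (φ.meridian b.base) (a.snd.map φ.toMap.continuous)
    (b.snd.map φ.toMap.continuous) φ.path₁
  rw [Path.map_symm, ← Path.map_trans, ← Path.map_trans, ← Path.map_trans] at this
  exact this

/-- The map induced on classes of path pairs. -/
def classMap : P.Classes → Q.Classes :=
  Quotient.map φ.pairMap fun _ _ h => φ.pairMap_rel h

/-- Conditions for a map of peripheral systems to induce an isomorphism of biquandles: it is
bijective on homotopy classes of paths with given endpoints, it meets every path component of the
boundary part, and paths in the boundary part of the target lift up to homotopy, where the homotopy
may leave the boundary part. -/
structure IsEquivalence : Prop where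
  full : ∀ {x y : X} (g : Path (φ.toMap x) (φ.toMap y)),
    ∃ g' : Path x y, (g'.map φ.toMap.continuous).Homotopic g
  faithful : ∀ {x y : X} {g g' : Path x y},
    (g.map φ.toMap.continuous).Homotopic (g'.map φ.toMap.continuous) → g.Homotopic g'
  joined : ∀ q : Q.bdry, ∃ p : P.bdry, Joined q (φ.bdryMap p)
  lift : ∀ {p p' : P.bdry} (γ : Path (φ.bdryMap p) (φ.bdryMap p')),
    ∃ γ' : Path p p', ((incl γ').map φ.toMap.continuous).Homotopic (incl γ)

variable {φ}

theorem IsEquivalence.surjective (h : φ.IsEquivalence) : Function.Surjective φ.classMap := by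
  intro b
  induction b using Quotient.inductionOn
  rename_i b
  obtain ⟨p, ⟨γ⟩⟩ := h.joined b.base
  obtain ⟨g₀, h₀⟩ := h.full (x := p) (y := P.z₀) (((incl γ).symm.trans b.fst).trans φ.path₀.symm)
  obtain ⟨g₁, h₁⟩ := h.full (x := p) (y := P.z₁) (((incl γ).symm.trans b.snd).trans φ.path₁.symm)
  refine ⟨Quotient.mk _ ⟨p, g₀, g₁⟩, Quotient.sound (Rel.symm (rel_iff.2 ⟨γ, ?_, ?_⟩))⟩
  · exact homotopic_trans_of_symm_trans _ _ _ h₀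
  · exact homotopic_trans_of_symm_trans _ _ _ h₁

theorem IsEquivalence.injective (h : φ.IsEquivalence) : Function.Injective φ.classMap := by
  intro a b e
  induction a using Quotient.inductionOn
  induction b using Quotient.inductionOn
  rename_i a b
  obtain ⟨γ, h₀, h₁⟩ := Rel.exists_path (Quotient.exact e : Rel (φ.pairMap a) (φ.pairMap b))
  obtain ⟨γ', hγ⟩ := h.lift γ
  refine Quotient.sound (rel_iff.2 ⟨γ', h.faithful ?_, h.faithful ?_⟩)
  · rw [Path.map_trans]
    exact of_trans_right hγ h₀
  · rw [Path.map_trans]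
    exact of_trans_right hγ h₁

theorem IsEquivalence.nonempty_iso (h : φ.IsEquivalence) :
    Nonempty (BiquandleIso P.Classes Q.Classes) := by
  refine ⟨⟨Equiv.ofBijective φ.classMap ⟨h.injective, h.surjective⟩, fun a b => ?_, fun a b => ?_⟩⟩
  · induction a using Quotient.inductionOn
    induction b using Quotient.inductionOn
    exact Quotient.sound (φ.pairMap_up _ _)
  · induction a using Quotient.inductionOn
    induction b using Quotient.inductionOn
    exact Quotient.sound (φ.pairMap_down _ _)

end PeripheralMap

/-! ### Smooth tubes -/

/-- An orientation preserving smooth embedding of `n` copies of `S¹ × ℂ` into the 3-sphere, that is,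
a parametrized tubular neighbourhood of an unspecified oriented link. -/
structure SmoothTube (n : ℕ) where
  map : Fin n → Circle → ℂ → S3
  smooth : ∀ i, ContMDiff ((𝓡 1).prod 𝓘(ℝ, ℂ)) (𝓡 3) ∞ fun p : Circle × ℂ => map i p.1 p.2
  injective : Function.Injective fun p : Fin n × Circle × ℂ => map p.1 p.2.1 p.2.2
  positive : ∀ i u z, 0 < det4 (map i u z)
    (deriv (fun t : ℝ => (map i (u * Circle.exp t) z : E4)) 0)
    (deriv (fun t : ℝ => (map i u (z + t) : E4)) 0)
    (deriv (fun t : ℝ => (map i u (z + t * Complex.I) : E4)) 0)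

/-- The parametrization of a tubular neighbourhood, without reference to the link. -/
def OrientedLink.Tube.toSmoothTube {L : OrientedLink} (T : L.Tube) : SmoothTube L.n :=
  ⟨T.map, T.smooth, T.injective, T.positive⟩

/-- If a linear combination of the four vectors vanishes and their determinant does not, then so do
the coefficients. -/
theorem coeff_eq_zero_of_det4_ne_zero {v₀ v₁ v₂ v₃ : E4} (h : det4 v₀ v₁ v₂ v₃ ≠ 0)
    {c₀ c₁ c₂ c₃ : ℝ} (e : c₀ • v₀ + c₁ • v₁ + c₂ • v₂ + c₃ • v₃ = 0) :
    c₀ = 0 ∧ c₁ = 0 ∧ c₂ = 0 ∧ c₃ = 0 := by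
  have := Matrix.eq_zero_of_vecMul_eq_zero h (v := ![c₀, c₁, c₂, c₃]) (by
    ext j
    have := congrArg (fun v : E4 => v j) e
    simpa [Matrix.vecMul, dotProduct, Fin.sum_univ_four] using this)
  exact ⟨congrFun this 0, congrFun this 1, congrFun this 2, congrFun this 3⟩

/-- Replacing the last three vectors by linear combinations, where the second one is only rescaled
and the first one may be added to the others. -/
theorem det4_combination (v₀ v₁ v₂ v₃ : E4) (r a₁ x₁ y₁ c₁ a₂ x₂ y₂ c₂ : ℝ) :
    det4 v₀ (r • v₁) (a₁ • v₁ + x₁ • v₂ + y₁ • v₃ + c₁ • v₀) (a₂ • v₁ + x₂ • v₂ + y₂ • v₃ + c₂ • v₀)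
      = r * (x₁ * y₂ - y₁ * x₂) * det4 v₀ v₁ v₂ v₃ := by
  simp [det4, Matrix.det_succ_row_zero, Fin.sum_univ_succ, Fin.succAbove]
  ring

theorem S3.norm_coe (x : S3) : ‖(x : E4)‖ = 1 := by simp

theorem S3.eq_of_smul_eq {x y : S3} {r : ℝ} (hr : 0 ≤ r) (h : r • (x : E4) = y) : x = y := by
  have := congrArg norm h
  rw [norm_smul, S3.norm_coe, S3.norm_coe, Real.norm_of_nonneg hr, mul_one] at this
  rw [this, one_smul] at h
  exact Subtype.ext h

theorem contMDiff_coe_S3 : ContMDiff (𝓡 3) 𝓘(ℝ, E4) ∞ fun y : S3 => (y : E4) :=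
  haveI : Fact (Module.finrank ℝ E4 = 3 + 1) := ⟨finrank_euclideanSpace_fin⟩
  contMDiff_coe_sphere

namespace SmoothTube

variable {n : ℕ} (S : SmoothTube n)

/-- The embedding, as a map on the disjoint union of the copies of `S¹ × ℂ`. -/
def emb (q : Fin n × Circle × ℂ) : S3 := S.map q.1 q.2.1 q.2.2

theorem continuous_emb : Continuous S.emb :=
  continuous_prod_of_discrete_left.2 fun i => (S.smooth i).continuous

/-- The cone on the tube in `ℝ⁴`, in coordinates around `u` of the circle: as the tube has
codimension zero in the sphere, this is a local diffeomorphism of 4-dimensional vector spaces. -/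
def cone (i : Fin n) (u : Circle) (p : ℝ × ℂ × ℝ) : E4 :=
  p.2.2 • (S.map i (u * Circle.exp p.1) p.2.1 : E4)

theorem contDiff_cone (i : Fin n) (u : Circle) : ContDiff ℝ ∞ (S.cone i u) := by
  have h1 : ContMDiff 𝓘(ℝ, ℝ × ℂ × ℝ) (𝓡 1) ∞ fun p : ℝ × ℂ × ℝ => u * Circle.exp p.1 :=
    contMDiff_const.mul (contMDiff_circleExp.comp contDiff_fst.contMDiff)
  have h2 : ContMDiff 𝓘(ℝ, ℝ × ℂ × ℝ) 𝓘(ℝ, ℂ) ∞ fun p : ℝ × ℂ × ℝ => p.2.1 :=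
    (contDiff_fst.comp contDiff_snd).contMDiff
  have h3 : ContMDiff 𝓘(ℝ, ℝ × ℂ × ℝ) 𝓘(ℝ, E4) ∞
      fun p : ℝ × ℂ × ℝ => (S.map i (u * Circle.exp p.1) p.2.1 : E4) :=
    contMDiff_coe_S3.comp ((S.smooth i).comp (h1.prodMk h2))
  exact (contDiff_snd.comp contDiff_snd).smul h3.contDiff

theorem hasStrictFDerivAt_cone (i : Fin n) (u : Circle) (p : ℝ × ℂ × ℝ) :
    HasStrictFDerivAt (S.cone i u) (fderiv ℝ (S.cone i u) p) p :=
  (S.contDiff_cone i u).contDiffAt.hasStrictFDerivAt (by simp)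

/-- The derivative of the tube in the direction of the circle. -/
def dCircle (i : Fin n) (u : Circle) (z : ℂ) : E4 :=
  deriv (fun t : ℝ => (S.map i (u * Circle.exp t) z : E4)) 0

/-- The derivative of the tube in the real direction. -/
def dRe (i : Fin n) (u : Circle) (z : ℂ) : E4 :=
  deriv (fun t : ℝ => (S.map i u (z + t) : E4)) 0

/-- The derivative of the tube in the imaginary direction. -/
def dIm (i : Fin n) (u : Circle) (z : ℂ) : E4 :=
  deriv (fun t : ℝ => (S.map i u (z + t * Complex.I) : E4)) 0

theorem fderiv_cone_apply (i : Fin n) (u : Circle) (z : ℂ) (a : ℝ) (b : ℂ) (c : ℝ) :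
    fderiv ℝ (S.cone i u) (0, z, 1) (a, b, c) =
      a • S.dCircle i u z + b.re • S.dRe i u z + b.im • S.dIm i u z + c • (S.map i u z : E4) := by
  have hD := (S.hasStrictFDerivAt_cone i u (0, z, 1)).hasFDerivAt
  have key : ∀ v : ℝ × ℂ × ℝ, HasDerivAt (fun t : ℝ => S.cone i u ((0, z, 1) + t • v))
      (fderiv ℝ (S.cone i u) (0, z, 1) v) 0 := fun v => hD.hasLineDerivAt v
  have e1 : fderiv ℝ (S.cone i u) (0, z, 1) (1, 0, 0) = S.dCircle i u z := by
    rw [← (key (1, 0, 0)).deriv]; simp [cone, dCircle]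
  have e2 : fderiv ℝ (S.cone i u) (0, z, 1) (0, 1, 0) = S.dRe i u z := by
    rw [← (key (0, 1, 0)).deriv]; simp [cone, dRe]
  have e3 : fderiv ℝ (S.cone i u) (0, z, 1) (0, Complex.I, 0) = S.dIm i u z := by
    rw [← (key (0, Complex.I, 0)).deriv]; simp [cone, dIm]
  have e4 : fderiv ℝ (S.cone i u) (0, z, 1) (0, 0, 1) = (S.map i u z : E4) := by
    rw [← (key (0, 0, 1)).deriv]
    have : HasDerivAt (fun t : ℝ => (1 + t) • (S.map i u z : E4)) ((1 : ℝ) • (S.map i u z : E4)) 0 :=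
      ((hasDerivAt_id (0 : ℝ)).const_add 1).smul_const _
    simpa [cone] using this.deriv
  have hv : ((a, b, c) : ℝ × ℂ × ℝ) = a • ((1, 0, 0) : ℝ × ℂ × ℝ) + b.re • ((0, 1, 0) : ℝ × ℂ × ℝ)
      + b.im • ((0, Complex.I, 0) : ℝ × ℂ × ℝ) + c • ((0, 0, 1) : ℝ × ℂ × ℝ) := by
    simp [Complex.re_add_im]
  rw [hv]
  simp only [map_add, map_smul, e1, e2, e3, e4]

theorem fderiv_cone_injective (i : Fin n) (u : Circle) (z : ℂ) :
    Function.Injective (fderiv ℝ (S.cone i u) (0, z, 1)) := by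
  refine (injective_iff_map_eq_zero _).2 ?_
  rintro ⟨a, b, c⟩ h
  rw [fderiv_cone_apply] at h
  obtain ⟨h0, h1, h2, h3⟩ := coeff_eq_zero_of_det4_ne_zero (S.positive i u z).ne'
    (c₀ := c) (c₁ := a) (c₂ := b.re) (c₃ := b.im) (by rw [← h]; simp only [dCircle, dRe, dIm]; abel)
  simp [h0, h1, Complex.ext_iff, h2, h3]

/-- The derivative of the cone on the tube, as an isomorphism. -/
def fderivCone (i : Fin n) (u : Circle) (z : ℂ) : (ℝ × ℂ × ℝ) ≃L[ℝ] E4 :=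
  (LinearMap.linearEquivOfInjective (fderiv ℝ (S.cone i u) (0, z, 1)).toLinearMap
    (S.fderiv_cone_injective i u z) (by simp)).toContinuousLinearEquiv

theorem hasStrictFDerivAt_cone_equiv (i : Fin n) (u : Circle) (z : ℂ) :
    HasStrictFDerivAt (S.cone i u) (S.fderivCone i u z : (ℝ × ℂ × ℝ) →L[ℝ] E4) (0, z, 1) :=
  S.hasStrictFDerivAt_cone i u _

/-- By the inverse function theorem for the cone, whose values on the sphere come from points of the
tube itself. -/
theorem isOpenEmbedding_emb : IsOpenEmbedding S.emb := by
  refine .of_continuous_injective_isOpenMap S.continuous_emb S.injective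
    (isOpenMap_iff_nhds_le.2 ?_)
  rintro ⟨i, u, z⟩ U hU
  have h1 := (S.hasStrictFDerivAt_cone_equiv i u z).map_nhds_eq_of_equiv
  have e1 : S.cone i u (0, z, 1) = (S.emb (i, u, z) : E4) := by simp [cone, emb]
  have hV : {p : ℝ × ℂ × ℝ | S.emb (i, u * Circle.exp p.1, p.2.1) ∈ U ∧ 0 < p.2.2} ∈
      𝓝 ((0, z, 1) : ℝ × ℂ × ℝ) := by
    have hc : Continuous fun p : ℝ × ℂ × ℝ => (i, u * Circle.exp p.1, p.2.1) := by fun_prop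
    have := hc.continuousAt.preimage_mem_nhds (x := ((0, z, 1) : ℝ × ℂ × ℝ)) (t := S.emb ⁻¹' U)
      (by simpa using hU)
    refine inter_mem this ?_
    exact (isOpen_lt (f := fun _ : ℝ × ℂ × ℝ => (0 : ℝ)) (g := fun p => p.2.2) continuous_const
      (by fun_prop)).mem_nhds (by simp)
  have h2 := image_mem_map (m := S.cone i u) hV
  rw [h1, e1] at h2
  have h3 := continuous_subtype_val.continuousAt.preimage_mem_nhds (x := S.emb (i, u, z)) h2
  filter_upwards [h3]
  rintro x ⟨p, ⟨hp, h0⟩, e⟩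
  have := S3.eq_of_smul_eq h0.le e
  rwa [← this]

end SmoothTube

/-! ### The peripheral system of a punctured tube -/

theorem Path.Homotopic.of_square {X : Type*} [TopologicalSpace X] {x y : X} (K : C(I × I, X))
    (a b : Path x y) (ha : ∀ s, K (0, s) = a s) (hb : ∀ s, K (1, s) = b s)
    (hx : ∀ t, K (t, 0) = x) (hy : ∀ t, K (t, 1) = y) : a.Homotopic b :=
  ((Path.Homotopic.trans_refl a).symm.trans
    (PeripheralSystem.square K a b (Path.refl x) (Path.refl y) ha hb hx hy)).trans
    (Path.Homotopic.refl_trans b)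

theorem Path.Homotopic.of_apply_eq {X : Type*} [TopologicalSpace X] {x y : X} {a b : Path x y}
    (h : ∀ t, a t = b t) : a.Homotopic b := by
  rw [Path.ext (funext h)]

/-- The disjoint union of `n` copies of `S¹ × (ℂ ∖ {0})`. -/
abbrev PuncturedTube (n : ℕ) := {q : Fin n × Circle × ℂ // q.2.2 ≠ 0}

namespace PuncturedTube

variable {n : ℕ}

/-- The distance from the core. -/
def radius (q : PuncturedTube n) : ℝ := ‖q.1.2.2‖

theorem radius_pos (q : PuncturedTube n) : 0 < q.radius := norm_pos_iff.2 q.2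

@[fun_prop]
theorem continuous_radius : Continuous (radius : PuncturedTube n → ℝ) := by
  unfold radius; fun_prop

/-- Multiplication of the complex coordinate by a nonzero number. -/
def mul (c : ℂ) (hc : c ≠ 0) (q : PuncturedTube n) : PuncturedTube n :=
  ⟨(q.1.1, q.1.2.1, q.1.2.2 * c), mul_ne_zero q.2 hc⟩

theorem mul_one (q : PuncturedTube n) (h : (1 : ℂ) ≠ 0) : mul 1 h q = q := by simp [mul]

theorem mul_eq_self {c : ℂ} {hc : c ≠ 0} (h : c = 1) (q : PuncturedTube n) : mul c hc q = q := by
  subst h; exact q.mul_one hc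

theorem radius_mul (q : PuncturedTube n) (c : ℂ) (hc : c ≠ 0) :
    (mul c hc q).radius = q.radius * ‖c‖ := norm_mul _ _

theorem continuous_mul {Z : Type*} [TopologicalSpace Z] {c : Z → ℂ} (hc : ∀ x, c x ≠ 0)
    {q : Z → PuncturedTube n} (h : Continuous c) (hq : Continuous q) :
    Continuous fun x => mul (c x) (hc x) (q x) := by
  unfold mul; fun_prop

end PuncturedTube

namespace SmoothTube

open PuncturedTube

variable {n m : ℕ} (S : SmoothTube n) (S' : SmoothTube m) {K : Set S3}

/-- The link formed by the core curves. -/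
def core : Set S3 := {x | ∃ i u, S.map i u 0 = x}

theorem emb_mem_core (q : Fin n × Circle × ℂ) : S.emb q ∈ S.core ↔ q.2.2 = 0 := by
  constructor
  · rintro ⟨i, u, h⟩
    have := S.injective (a₁ := (i, u, 0)) (a₂ := q) h
    rw [← this]
  · intro h
    exact ⟨q.1, q.2.1, by rw [emb, h]⟩

variable (hK : S.core = K) (hK' : S'.core = K)

/-- The embedding of the punctured tube into the link complement. -/
def pt (q : PuncturedTube n) : ↥Kᶜ :=
  ⟨S.emb q, fun h => q.2 ((S.emb_mem_core _).1 (hK ▸ h))⟩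

theorem isEmbedding_pt : IsEmbedding (S.pt hK) :=
  (S.isOpenEmbedding_emb.isEmbedding.comp .subtypeVal).codRestrict Kᶜ _

@[fun_prop]
theorem continuous_pt : Continuous (S.pt hK) := (S.isEmbedding_pt hK).continuous

/-- The coordinates of a point of the punctured tube. -/
def coord : range (S.pt hK) ≃ₜ PuncturedTube n := (S.isEmbedding_pt hK).toHomeomorph.symm

theorem pt_coord (x : range (S.pt hK)) : S.pt hK (S.coord hK x) = x :=
  congrArg Subtype.val ((S.isEmbedding_pt hK).toHomeomorph.apply_symm_apply x)

theorem coord_pt (q : PuncturedTube n) (h : S.pt hK q ∈ range (S.pt hK)) :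
    S.coord hK ⟨S.pt hK q, h⟩ = q :=
  (S.isEmbedding_pt hK).injective (S.pt_coord hK _)

/-- The part of the punctured tube up to radius `r`. -/
def shell (r : ℝ) : Set ↥Kᶜ := {x | ∃ q, radius q ≤ r ∧ S.pt hK q = x}

theorem shell_subset_range (r : ℝ) : S.shell hK r ⊆ range (S.pt hK) :=
  fun _ ⟨q, _, h⟩ => ⟨q, h⟩

theorem pt_mem_shell {q : PuncturedTube n} {r : ℝ} : S.pt hK q ∈ S.shell hK r ↔ radius q ≤ r := by
  refine ⟨?_, fun h => ⟨q, h, rfl⟩⟩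
  rintro ⟨q', h, e⟩
  rwa [← (S.isEmbedding_pt hK).injective e]

theorem exp_ne_zero (t : ℝ) : (Circle.exp t : ℂ) ≠ 0 := Circle.coe_ne_zero _

/-- The meridian loop at a point of the punctured tube. -/
def meridianAt (x : ↥Kᶜ) (hx : x ∈ range (S.pt hK)) : Path x x where
  toFun t := S.pt hK (mul (Circle.exp (2 * Real.pi * t)) (exp_ne_zero _) (S.coord hK ⟨x, hx⟩))
  continuous_toFun := (S.continuous_pt hK).comp (continuous_mul _ (by fun_prop) continuous_const)
  source' := by simp [mul_one, pt_coord]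
  target' := by simp [mul_one, pt_coord]

theorem meridianAt_eq {x : ↥Kᶜ} (hx : x ∈ range (S.pt hK)) {q : PuncturedTube n}
    (h : S.pt hK q = x) (t : I) : S.meridianAt hK x hx t =
      S.pt hK (mul (Circle.exp (2 * Real.pi * t)) (exp_ne_zero _) q) := by
  subst h
  simp [meridianAt, coord_pt]

/-- The link complement, with the shell of radius `r` around the link as boundary part and the
meridians of the tube. -/
def system (r : ℝ) (z₀ z₁ : ↥Kᶜ) : PeripheralSystem ↥Kᶜ where
  bdry := S.shell hK r
  mer p :=
    { toFun := fun t => ⟨S.meridianAt hK p (S.shell_subset_range hK r p.2) t, by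
        change S.pt hK _ ∈ S.shell hK r
        rw [pt_mem_shell, radius_mul, Circle.norm_coe, _root_.mul_one, ← S.pt_mem_shell hK,
          pt_coord]
        exact p.2⟩
      continuous_toFun := by fun_prop
      source' := by simp
      target' := by simp }
  mer_continuous := by
    refine Continuous.subtype_mk ((S.continuous_pt hK).comp (continuous_mul _ (by fun_prop) ?_)) _
    exact (S.coord hK).continuous.comp (Continuous.subtype_mk (by fun_prop) _)
  z₀ := z₀
  z₁ := z₁

theorem meridian_system (r : ℝ) (z₀ z₁ : ↥Kᶜ) (p : (S.system hK r z₀ z₁).bdry) :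
    (S.system hK r z₀ z₁).meridian p = S.meridianAt hK p (S.shell_subset_range hK r p.2) := rfl

/-- Meridians at the ends of a path in the punctured tube are conjugate along the path. -/
theorem meridianAt_conj (c : C(I, PuncturedTube n)) {x y : ↥Kᶜ} (γ : Path x y)
    (h : ∀ t, S.pt hK (c t) = γ t) (hx : x ∈ range (S.pt hK)) (hy : y ∈ range (S.pt hK)) :
    ((S.meridianAt hK x hx).trans γ).Homotopic (γ.trans (S.meridianAt hK y hy)) := by
  obtain rfl : S.pt hK (c 0) = x := by rw [h, γ.source]
  obtain rfl : S.pt hK (c 1) = y := by rw [h, γ.target]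
  refine PeripheralSystem.square ⟨fun p : I × I =>
    S.pt hK (mul (Circle.exp (2 * Real.pi * p.2)) (exp_ne_zero _) (c p.1)), ?_⟩ _ _ _ _ ?_ ?_ ?_ ?_
  · exact (S.continuous_pt hK).comp (continuous_mul _ (by fun_prop) (by fun_prop))
  · intro t; exact (S.meridianAt_eq hK _ rfl t).symm
  · intro t; exact (S.meridianAt_eq hK _ rfl t).symm
  · intro t; simp [mul_one, h]
  · intro t; simp [mul_one, h]

/-- A path in the punctured tube can be rescaled radially, if the scaling factor is 1 at the
endpoints. -/
theorem exists_homotopic_rescale {x y : ↥Kᶜ} (γ : Path x y) (hγ : ∀ t, γ t ∈ range (S.pt hK))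
    {f : ℝ → ℝ} (hf : ContinuousOn f (Ioi 0)) (hpos : ∀ ρ, 0 < ρ → 0 < f ρ)
    (hx : ∀ q, S.pt hK q = x → f (radius q) = 1) (hy : ∀ q, S.pt hK q = y → f (radius q) = 1) :
    ∃ γ' : Path x y, γ'.Homotopic γ ∧
      ∀ t, ∃ q, S.pt hK q = γ' t ∧
        ∃ q', S.pt hK q' = γ t ∧ radius q = radius q' * f (radius q') := by
  let c : I → PuncturedTube n := fun t => S.coord hK ⟨γ t, hγ t⟩
  have hc : Continuous c := (S.coord hK).continuous.comp (Continuous.subtype_mk γ.continuous _)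
  have hpt : ∀ t, S.pt hK (c t) = γ t := fun t => S.pt_coord hK _
  have hfc : Continuous fun t => f (radius (c t)) :=
    hf.comp_continuous (by fun_prop) fun t => radius_pos _
  have hg : ∀ p : I × I, 0 < (1 - p.1 : ℝ) + p.1 * f (radius (c p.2)) := by
    intro p
    have h1 := hpos _ (radius_pos (c p.2))
    have h2 := mul_nonneg p.1.2.1 h1.le
    rcases eq_or_lt_of_le p.1.2.2 with h | h
    · rw [h]; simpa using h1
    · linarith
  have hne : ∀ p : I × I, (((1 - p.1 : ℝ) + p.1 * f (radius (c p.2)) : ℝ) : ℂ) ≠ 0 :=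
    fun p => Complex.ofReal_ne_zero.2 (hg p).ne'
  let F : C(I × I, ↥Kᶜ) := ⟨fun p => S.pt hK (mul _ (hne p) (c p.2)), by
    refine (S.continuous_pt hK).comp (continuous_mul _ ?_ (by fun_prop))
    have : Continuous fun p : I × I => f (radius (c p.2)) := hfc.comp continuous_snd
    have h' : Continuous fun p : I × I => (p.1 : ℝ) := by fun_prop
    exact Complex.continuous_ofReal.comp ((continuous_const.sub h').add (h'.mul this))⟩
  have F0 : ∀ t, F (0, t) = γ t := fun t => by
    change S.pt hK (mul _ _ (c t)) = _
    rw [mul_eq_self (by simp), hpt]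
  have Fx : ∀ t, F (t, 0) = x := fun t => by
    change S.pt hK (mul _ _ (c 0)) = _
    rw [mul_eq_self, hpt, γ.source]
    rw [hx (c 0) (by rw [hpt, γ.source])]; simp
  have Fy : ∀ t, F (t, 1) = y := fun t => by
    change S.pt hK (mul _ _ (c 1)) = _
    rw [mul_eq_self, hpt, γ.target]
    rw [hy (c 1) (by rw [hpt, γ.target])]; simp
  refine ⟨⟨⟨fun t => F (1, t), by fun_prop⟩, Fx 1, Fy 1⟩, ?_, fun t => ⟨_, rfl, c t, hpt t, ?_⟩⟩
  · exact (Path.Homotopic.of_square F γ _ F0 (fun _ => rfl) Fx Fy).symm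
  · rw [radius_mul, Complex.norm_real, Real.norm_of_nonneg (hg (1, t)).le]
    simp

/-- The radial segment from a point of the tube inwards. -/
theorem exists_radial_path (q : PuncturedTube n) {a : ℝ} (h0 : 0 < a) (h1 : a ≤ 1) :
    ∃ c : C(I, PuncturedTube n), c 0 = q ∧
      c 1 = mul (a : ℂ) (Complex.ofReal_ne_zero.2 h0.ne') q ∧ ∀ t, radius (c t) ≤ radius q := by
  have hg : ∀ t : I, 0 < (1 - t : ℝ) + t * a := by
    intro t
    rcases eq_or_lt_of_le t.2.2 with h | h
    · rw [h]; simpa using h0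
    · have := mul_nonneg t.2.1 h0.le
      linarith
  refine ⟨⟨fun t => mul _ (Complex.ofReal_ne_zero.2 (hg t).ne') q,
    continuous_mul _ (by fun_prop) continuous_const⟩, ?_, ?_, fun t => ?_⟩
  · exact mul_eq_self (hc := Complex.ofReal_ne_zero.2 (hg 0).ne') (by simp) q
  · simp [mul]
  · change radius (mul _ (Complex.ofReal_ne_zero.2 (hg t).ne') q) ≤ _
    rw [radius_mul, Complex.norm_real, Real.norm_of_nonneg (hg t).le]
    refine mul_le_of_le_one_right (radius_pos q).le ?_
    nlinarith [t.2.1]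

/-- Shrinking the boundary part from a shell of one tube to a shell of another tube with the same
core does not change the biquandle, if the shells of the two tubes are interleaved. Paths in the
larger shell are pushed into the smaller one along the radii of the other tube. -/
theorem nonempty_iso_of_interleaved {s r s' : ℝ} (hs : 0 < s) (hs' : 0 < s')
    (h₁ : S.shell hK s ⊆ S'.shell hK' r) (h₂ : S'.shell hK' r ⊆ range (S.pt hK))
    (h₃ : S'.shell hK' s' ⊆ S.shell hK s)
    (hmer : ∀ x (hx : x ∈ range (S.pt hK)) (hx' : x ∈ range (S'.pt hK')), x ∈ S.shell hK s →
      (S.meridianAt hK x hx).Homotopic (S'.meridianAt hK' x hx'))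
    {z₀ z₁ w₀ w₁ : ↥Kᶜ} (δ₀ : Path z₀ w₀) (δ₁ : Path z₁ w₁) :
    Nonempty (BiquandleIso (S.system hK s z₀ z₁).Classes (S'.system hK' r w₀ w₁).Classes) := by
  let φ : PeripheralMap (S.system hK s z₀ z₁) (S'.system hK' r w₀ w₁) :=
    { toMap := ContinuousMap.id _
      path₀ := δ₀
      path₁ := δ₁
      mapsTo := fun p => h₁ p.2
      meridian := fun p => hmer p _ _ p.2 }
  refine PeripheralMap.IsEquivalence.nonempty_iso (φ := φ) ⟨?_, ?_, ?_, ?_⟩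
  · intro x y g
    exact ⟨g, Path.Homotopic.refl _⟩
  · intro x y g g' h
    exact h
  · rintro ⟨_, q, hq, rfl⟩
    have ha : 0 < min 1 (s' / radius q) := lt_min one_pos (div_pos hs' (radius_pos q))
    obtain ⟨c, c0, c1, hc⟩ := exists_radial_path q ha (min_le_left _ _)
    have hmem : S'.pt hK' (c 1) ∈ S.shell hK s := by
      refine h₃ ((S'.pt_mem_shell hK').2 ?_)
      rw [c1, radius_mul, Complex.norm_real, Real.norm_of_nonneg ha.le]
      calc radius q * min 1 (s' / radius q) ≤ radius q * (s' / radius q) :=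
            mul_le_mul_of_nonneg_left (min_le_right _ _) (radius_pos q).le
        _ = s' := mul_div_cancel₀ _ (radius_pos q).ne'
    refine ⟨⟨_, hmem⟩, ⟨⟨⟨fun t => ⟨S'.pt hK' (c t),
      (S'.pt_mem_shell hK').2 ((hc t).trans hq)⟩, by fun_prop⟩, ?_, rfl⟩⟩⟩
    exact Subtype.ext (congrArg (S'.pt hK') c0)
  · intro p p' γ
    -- radii above `s`, measured in the first tube, are cut down to `s`
    have key : ∀ p : (S.system hK s z₀ z₁).bdry, ∀ q, S.pt hK q = p →
        min 1 (s / radius q) = 1 := by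
      intro p q hq
      refine min_eq_left ((one_le_div (radius_pos q)).2 ?_)
      rw [← S.pt_mem_shell hK, hq]; exact p.2
    obtain ⟨γ', hh, hγ'⟩ := S.exists_homotopic_rescale hK (PeripheralSystem.PathPair.incl γ)
      (fun t => h₂ (γ t).2) (f := fun ρ => min 1 (s / ρ))
      (continuousOn_const.inf (continuousOn_const.div continuousOn_id fun x hx => ne_of_gt hx))
      (fun ρ hρ => lt_min one_pos (div_pos hs hρ)) (key p) (key p')
    have hm : ∀ t, γ' t ∈ S.shell hK s := by
      intro t
      obtain ⟨q, hq, q', -, e⟩ := hγ' t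
      refine ⟨q, ?_, hq⟩
      rw [e]
      calc radius q' * min 1 (s / radius q') ≤ radius q' * (s / radius q') :=
            mul_le_mul_of_nonneg_left (min_le_right _ _) (radius_pos q').le
        _ = s := mul_div_cancel₀ _ (radius_pos q').ne'
    exact ⟨⟨⟨fun t => ⟨γ' t, hm t⟩, by fun_prop⟩, Subtype.ext γ'.source, Subtype.ext γ'.target⟩, hh⟩

/-- The radius of the shell does not matter. -/
theorem nonempty_iso_radius {s r : ℝ} (hs : 0 < s) (h : s ≤ r) (z₀ z₁ : ↥Kᶜ) :
    Nonempty (BiquandleIso (S.system hK s z₀ z₁).Classes (S.system hK r z₀ z₁).Classes) :=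
  S.nonempty_iso_of_interleaved S hK hK hs hs (fun _ ⟨q, hq, e⟩ => ⟨q, hq.trans h, e⟩)
    (S.shell_subset_range hK r) subset_rfl (fun _ _ _ _ => Path.Homotopic.refl _)
    (Path.refl z₀) (Path.refl z₁)

/-- A homeomorphism of the sphere that carries one tube to the other induces an isomorphism. -/
theorem nonempty_iso_of_homeomorph (S S' : SmoothTube n) (h : S3 ≃ₜ S3)
    (e : ∀ i u z, S'.map i u z = h (S.map i u z)) {K' : Set S3} (hK : S.core = K)
    (hK' : S'.core = K') (r : ℝ) (z₀ z₁ : ↥Kᶜ) :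
    ∃ w₀ w₁ : ↥K'ᶜ,
      Nonempty (BiquandleIso (S.system hK r z₀ z₁).Classes (S'.system hK' r w₀ w₁).Classes) := by
  have hmem : ∀ x, x ∈ Kᶜ ↔ h x ∈ K'ᶜ := by
    intro x
    rw [mem_compl_iff, mem_compl_iff, not_iff_not, ← hK, ← hK']
    constructor
    · rintro ⟨i, u, rfl⟩; exact ⟨i, u, e _ _ _⟩
    · rintro ⟨i, u, hx⟩
      rw [e] at hx
      exact ⟨i, u, h.injective hx⟩
  let H : ↥Kᶜ ≃ₜ ↥K'ᶜ := h.subtype hmem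
  have hpt : ∀ q, H (S.pt hK q) = S'.pt hK' q := fun q => Subtype.ext (e _ _ _).symm
  let φ : PeripheralMap (S.system hK r z₀ z₁) (S'.system hK' r (H z₀) (H z₁)) :=
    { toMap := H
      path₀ := Path.refl _
      path₁ := Path.refl _
      mapsTo := by
        rintro ⟨_, q, hq, rfl⟩
        exact ⟨q, hq, (hpt q).symm⟩
      meridian := by
        rintro ⟨_, q, hq, rfl⟩
        have : ∀ t, H (S.meridianAt hK (S.pt hK q) (mem_range_self q) t) =
            S'.meridianAt hK' (H (S.pt hK q)) ⟨q, (hpt q).symm⟩ t := by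
          intro t
          exact (congrArg H (S.meridianAt_eq hK _ rfl t)).trans
            ((hpt _).trans (S'.meridianAt_eq hK' _ (hpt q).symm t).symm)
        rw [meridian_system, meridian_system]
        exact Path.Homotopic.of_apply_eq this }
  refine ⟨H z₀, H z₁, PeripheralMap.IsEquivalence.nonempty_iso (φ := φ) ⟨?_, ?_, ?_, ?_⟩⟩
  · intro x y g
    refine ⟨(g.map H.symm.continuous).cast (H.symm_apply_apply x).symm
      (H.symm_apply_apply y).symm, ?_⟩
    exact Path.Homotopic.of_apply_eq fun t => H.apply_symm_apply (g t)
  · intro x y g g' hh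
    obtain ⟨F⟩ := hh
    refine Path.Homotopic.of_square ⟨fun p : I × I => H.symm (F p), by fun_prop⟩ _ _ ?_ ?_ ?_ ?_ <;>
    intro t <;> simp [φ]
  · rintro ⟨_, q, hq, rfl⟩
    refine ⟨⟨S.pt hK q, q, hq, rfl⟩, ?_⟩
    rw [show φ.bdryMap ⟨S.pt hK q, q, hq, rfl⟩ = ⟨S'.pt hK' q, q, hq, rfl⟩ from Subtype.ext (hpt q)]
  · intro p p' γ
    have hm : ∀ t, H.symm (γ t) ∈ S.shell hK r := by
      intro t
      obtain ⟨q, hq, e⟩ := (γ t).2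
      exact ⟨q, hq, by rw [← e, ← hpt, H.symm_apply_apply]⟩
    refine ⟨⟨⟨fun t => ⟨H.symm (γ t), hm t⟩, by fun_prop⟩, ?_, ?_⟩, ?_⟩
    · exact Subtype.ext ((congrArg (fun x => H.symm x.1) γ.source).trans (H.symm_apply_apply _))
    · exact Subtype.ext ((congrArg (fun x => H.symm x.1) γ.target).trans (H.symm_apply_apply _))
    · exact Path.Homotopic.of_apply_eq fun t => H.apply_symm_apply (γ t).1

end SmoothTube

/-! ### From the exterior to the link complement -/

namespace SmoothTube

open PuncturedTube

variable {n : ℕ} (S : SmoothTube n) {K : Set S3} (hK : S.core = K)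

theorem mem_range_pt (x : ↥Kᶜ) : x ∈ range (S.pt hK) ↔ (x : S3) ∈ range S.emb := by
  constructor
  · rintro ⟨q, rfl⟩
    exact ⟨q, rfl⟩
  · rintro ⟨q, h⟩
    refine ⟨⟨q, fun hq => x.2 ?_⟩, Subtype.ext h⟩
    exact hK ▸ h ▸ (S.emb_mem_core q).2 hq

theorem isOpenEmbedding_pt : IsOpenEmbedding (S.pt hK) := by
  refine ⟨S.isEmbedding_pt hK, ?_⟩
  have : range (S.pt hK) = Subtype.val ⁻¹' range S.emb := Set.ext (S.mem_range_pt hK)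
  rw [this]
  exact S.isOpenEmbedding_emb.isOpen_range.preimage continuous_subtype_val

theorem isClosed_image_closedBall (r : ℝ) : IsClosed (S.emb '' {q | ‖q.2.2‖ ≤ r}) := by
  have : {q : Fin n × Circle × ℂ | ‖q.2.2‖ ≤ r} = univ ×ˢ univ ×ˢ Metric.closedBall 0 r := by
    ext q; simp
  rw [this]
  exact ((isCompact_univ.prod (isCompact_univ.prod (isCompact_closedBall 0 r))).image
    S.continuous_emb).isClosed

/-- The radial push of the points at distance less than `t` from the core to distance `t`. Points
outside the tube are fixed. -/
def push (t : ℝ) : ↥Kᶜ → ↥Kᶜ :=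
  Function.extend (S.pt hK) (fun q => S.pt hK (mul ((max 1 (t / radius q) : ℝ) : ℂ)
    (Complex.ofReal_ne_zero.2 (lt_max_of_lt_left one_pos).ne') q)) id

theorem push_pt (t : ℝ) (q : PuncturedTube n) : S.push hK t (S.pt hK q) =
    S.pt hK (mul ((max 1 (t / radius q) : ℝ) : ℂ)
      (Complex.ofReal_ne_zero.2 (lt_max_of_lt_left one_pos).ne') q) :=
  (S.isEmbedding_pt hK).injective.extend_apply _ _ _

theorem push_of_notMem {t : ℝ} {x : ↥Kᶜ} (hx : x ∉ range (S.pt hK)) : S.push hK t x = x :=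
  Function.extend_apply' _ _ _ hx

theorem push_pt_of_le {t : ℝ} {q : PuncturedTube n} (h : t ≤ radius q) :
    S.push hK t (S.pt hK q) = S.pt hK q := by
  rw [push_pt, mul_eq_self]
  rw [max_eq_left ((div_le_one (radius_pos q)).2 h), Complex.ofReal_one]

theorem continuous_push : Continuous fun p : I × ↥Kᶜ => S.push hK p.1 p.2 := by
  rw [continuous_iff_continuousAt]
  rintro ⟨t, x⟩
  by_cases hx : x ∈ range (S.pt hK)
  · obtain ⟨q, rfl⟩ := hx
    refine ((IsOpenEmbedding.id.prodMap (S.isOpenEmbedding_pt hK)).continuousAt_iff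
      (x := (t, q))).1 (Continuous.continuousAt ?_)
    have : (fun p : I × ↥Kᶜ => S.push hK p.1 p.2) ∘ Prod.map id (S.pt hK) = fun p =>
        S.pt hK (mul ((max 1 (p.1 / radius p.2) : ℝ) : ℂ)
          (Complex.ofReal_ne_zero.2 (lt_max_of_lt_left one_pos).ne') p.2) :=
      funext fun p => S.push_pt hK _ _
    rw [this]
    refine (S.continuous_pt hK).comp (continuous_mul _ (Complex.continuous_ofReal.comp
      (continuous_const.max (Continuous.div (by fun_prop) (by fun_prop) ?_))) continuous_snd)
    exact fun p => (radius_pos p.2).ne'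
  · have hV : Subtype.val ⁻¹' (S.emb '' {q | ‖q.2.2‖ ≤ 1})ᶜ ∈ 𝓝 x := by
      refine ((S.isClosed_image_closedBall 1).isOpen_compl.preimage
        continuous_subtype_val).mem_nhds ?_
      rintro ⟨q, -, h⟩
      exact hx ((S.mem_range_pt hK x).2 ⟨q, h⟩)
    refine (continuousAt_snd (p := (t, x))).congr ?_
    filter_upwards [(continuousAt_snd (p := (t, x))).preimage_mem_nhds hV]
    rintro ⟨s, y⟩ hy
    by_cases h : y ∈ range (S.pt hK)
    · obtain ⟨q, rfl⟩ := h
      refine (S.push_pt_of_le hK (s.2.2.trans ?_)).symm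
      by_contra hlt
      exact hy ⟨q, (not_le.1 hlt).le, rfl⟩
    · exact (S.push_of_notMem hK h).symm

end SmoothTube

namespace OrientedLink.Tube

open PuncturedTube

variable {L : OrientedLink} (T : L.Tube) {K : Set S3} (hK : T.toSmoothTube.core = K)

theorem mem_exterior_iff (x : S3) :
    x ∈ T.exterior ↔ ∀ q, T.toSmoothTube.emb q = x → 1 ≤ ‖q.2.2‖ := by
  constructor
  · rintro hx q rfl
    by_contra! hq
    have hU : IsOpen (T.toSmoothTube.emb '' {q | ‖q.2.2‖ < 1}) :=
      T.toSmoothTube.isOpenEmbedding_emb.isOpenMap _ (isOpen_lt (by fun_prop) continuous_const)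
    obtain ⟨y, ⟨p, hp, rfl⟩, hy⟩ := mem_closure_iff.1 hx _ hU ⟨q, hq, rfl⟩
    exact hy ⟨p.1, p.2.1, p.2.2, le_of_lt hp, rfl⟩
  · intro h
    by_cases hx : x ∈ T.nbhd
    · obtain ⟨i, u, z, hz, rfl⟩ := hx
      have h1 := le_antisymm hz (h (i, u, z) rfl)
      exact T.map_mem_exterior i u ⟨z, mem_sphere_zero_iff_norm.2 h1⟩
    · exact subset_closure hx

/-- The inclusion of the exterior in the link complement. -/
def inclusion : C(T.exterior, ↥Kᶜ) where
  toFun x := ⟨x, by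
    rw [← hK]
    rintro ⟨i, u, h⟩
    have := (T.mem_exterior_iff x).1 x.2 (i, u, 0) h
    simp at this
    linarith⟩

theorem push_mem_exterior (x : ↥Kᶜ) : (T.toSmoothTube.push hK 1 x : S3) ∈ T.exterior := by
  rw [mem_exterior_iff]
  intro q hq
  by_cases hx : x ∈ range (T.toSmoothTube.pt hK)
  · obtain ⟨p, rfl⟩ := hx
    rw [SmoothTube.push_pt] at hq
    rw [T.toSmoothTube.injective hq]
    change 1 ≤ radius (mul _ _ p)
    rw [radius_mul, Complex.norm_real, Real.norm_of_nonneg (by positivity)]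
    calc (1 : ℝ) = radius p * (1 / radius p) := (mul_div_cancel₀ _ (radius_pos p).ne').symm
      _ ≤ _ := mul_le_mul_of_nonneg_left (le_max_right _ _) (radius_pos p).le
  · rw [SmoothTube.push_of_notMem _ _ hx] at hq
    exact absurd ((SmoothTube.mem_range_pt _ hK x).2 ⟨q, hq⟩) hx

theorem push_inclusion {t : ℝ} (ht : t ≤ 1) (x : T.exterior) :
    T.toSmoothTube.push hK t (T.inclusion hK x) = T.inclusion hK x := by
  by_cases hx : T.inclusion hK x ∈ range (T.toSmoothTube.pt hK)
  · obtain ⟨q, hq⟩ := hx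
    rw [← hq]
    refine SmoothTube.push_pt_of_le _ _ (ht.trans ?_)
    exact (T.mem_exterior_iff x).1 x.2 q (congrArg Subtype.val hq)
  · exact SmoothTube.push_of_notMem _ _ hx

/-- The radial retraction of the link complement onto the exterior. -/
def retraction : C(↥Kᶜ, T.exterior) where
  toFun x := ⟨T.toSmoothTube.push hK 1 x, T.push_mem_exterior hK x⟩
  continuous_toFun := by
    refine (continuous_subtype_val.comp ?_).subtype_mk _
    exact (T.toSmoothTube.continuous_push hK).comp
      (f := fun x => ((1 : I), x)) (by fun_prop)

theorem retraction_inclusion (x : T.exterior) : T.retraction hK (T.inclusion hK x) = x := by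
  have h := congrArg Subtype.val (T.push_inclusion hK le_rfl x)
  exact Subtype.ext h

theorem push_zero (x : ↥Kᶜ) : T.toSmoothTube.push hK 0 x = x := by
  by_cases hx : x ∈ range (T.toSmoothTube.pt hK)
  · obtain ⟨q, rfl⟩ := hx
    exact SmoothTube.push_pt_of_le _ _ (radius_pos q).le
  · exact SmoothTube.push_of_notMem _ _ hx

/-- A point of the boundary torus, as a point of the punctured tube. -/
def toPunctured (q : Fin L.n × Circle × Circle) : PuncturedTube L.n :=
  ⟨(q.1, q.2.1, q.2.2), Circle.coe_ne_zero _⟩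

theorem radius_toPunctured (q : Fin L.n × Circle × Circle) : (toPunctured q).radius = 1 :=
  Circle.norm_coe _

theorem inclusion_torusMap (q : Fin L.n × Circle × Circle) :
    T.inclusion hK (T.torusMap q) = T.toSmoothTube.pt hK (toPunctured q) := rfl

theorem inclusion_mem_boundary (x : T.exterior) (q : PuncturedTube L.n) (hq : radius q = 1)
    (h : T.toSmoothTube.pt hK q = T.inclusion hK x) : x ∈ T.boundary := by
  have h := congrArg Subtype.val h
  exact ⟨(q.1.1, q.1.2.1, ⟨q.1.2.2, mem_sphere_zero_iff_norm.2 hq⟩), Subtype.ext h⟩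

theorem inclusion_mer (p : T.boundary) (hp) (t : I) :
    T.inclusion hK (T.mer p t) = T.toSmoothTube.meridianAt hK (T.inclusion hK p) hp t := by
  obtain ⟨q, rfl⟩ := T.torusHomeo.surjective p
  rw [SmoothTube.meridianAt_eq _ _ hp (q := toPunctured q) rfl]
  change T.inclusion hK (T.torusHomeo _) = _
  rw [Homeomorph.symm_apply_apply]
  rfl

end OrientedLink.Tube

/-- The topological biquandle can be computed in the link complement, with the punctured unit disc
bundle in place of the boundary torus. The ball only matters through the basepoints. -/
theorem OrientedLink.Choices.nonempty_iso_system {L : OrientedLink} (D : L.Choices) {K : Set S3}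
    (hK : D.tube.toSmoothTube.core = K) : ∃ z₀ z₁ : ↥Kᶜ,
      Nonempty (BiquandleIso (TopologicalBiquandle L D)
        (D.tube.toSmoothTube.system hK 1 z₀ z₁).Classes) := by
  let T := D.tube
  let ι := T.inclusion hK
  let ρ := T.retraction hK
  have hι : ∀ p : T.boundary, ι p ∈ T.toSmoothTube.shell hK 1 := by
    rintro ⟨_, q, rfl⟩
    exact ⟨Tube.toPunctured q, (Tube.radius_toPunctured q).le, rfl⟩
  let φ : PeripheralMap D.peripheralSystem
      (T.toSmoothTube.system hK 1 (ι D.peripheralSystem.z₀) (ι D.peripheralSystem.z₁)) :=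
    { toMap := ι
      path₀ := Path.refl _
      path₁ := Path.refl _
      mapsTo := hι
      meridian := fun p => Path.Homotopic.of_apply_eq fun t => T.inclusion_mer hK p _ t }
  refine ⟨_, _, PeripheralMap.IsEquivalence.nonempty_iso (φ := φ) ⟨?_, ?_, ?_, ?_⟩⟩
  · intro x y g
    refine ⟨(g.map ρ.continuous).cast (T.retraction_inclusion hK x).symm
      (T.retraction_inclusion hK y).symm, Path.Homotopic.symm ?_⟩
    refine Path.Homotopic.of_square ⟨fun p : I × I => T.toSmoothTube.push hK p.1 (g p.2),
      (T.toSmoothTube.continuous_push hK).comp (f := fun p : I × I => (p.1, g p.2)) (by fun_prop)⟩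
      _ _ ?_ ?_ ?_ ?_
    · intro t; exact T.push_zero hK _
    · intro t; rfl
    · intro t
      change T.toSmoothTube.push hK t (g 0) = _
      rw [g.source]
      exact T.push_inclusion hK t.2.2 x
    · intro t
      change T.toSmoothTube.push hK t (g 1) = _
      rw [g.target]
      exact T.push_inclusion hK t.2.2 y
  · intro x y g g' h
    obtain ⟨F⟩ := h
    refine Path.Homotopic.of_square ⟨fun p : I × I => ρ (F p), by fun_prop⟩ _ _ ?_ ?_ ?_ ?_
    · intro t; exact (congrArg ρ (F.apply_zero t)).trans (T.retraction_inclusion hK _)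
    · intro t; exact (congrArg ρ (F.apply_one t)).trans (T.retraction_inclusion hK _)
    · intro t; exact (congrArg ρ (F.source t)).trans (T.retraction_inclusion hK _)
    · intro t; exact (congrArg ρ (F.target t)).trans (T.retraction_inclusion hK _)
  · rintro ⟨_, q, hq, rfl⟩
    have h0 := PuncturedTube.radius_pos q
    -- the boundary point on the ray through `q`, and the segment of that ray down to `q`
    have hc : ((q.radius⁻¹ : ℝ) : ℂ) ≠ 0 := Complex.ofReal_ne_zero.2 (inv_pos.2 h0).ne'
    have hr : (PuncturedTube.mul _ hc q).radius = 1 := by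
      rw [PuncturedTube.radius_mul, Complex.norm_real, Real.norm_of_nonneg (inv_pos.2 h0).le,
        mul_inv_cancel₀ h0.ne']
    obtain ⟨c, c0, c1, hc'⟩ := SmoothTube.exists_radial_path (PuncturedTube.mul _ hc q) h0 hq
    rw [hr] at hc'
    have hcq : c 1 = q := by
      rw [c1]
      refine Subtype.ext (Prod.ext rfl (Prod.ext rfl ?_))
      change q.1.2.2 * _ * _ = _
      rw [mul_assoc, ← Complex.ofReal_mul, inv_mul_cancel₀ h0.ne', Complex.ofReal_one, mul_one]
    let b : Fin L.n × Circle × Circle := (q.1.1, q.1.2.1,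
      ⟨(PuncturedTube.mul _ hc q).1.2.2, mem_sphere_zero_iff_norm.2 hr⟩)
    refine ⟨⟨T.torusMap b, b, rfl⟩, Joined.symm ⟨⟨⟨fun t => ⟨T.toSmoothTube.pt hK (c t),
      (T.toSmoothTube.pt_mem_shell hK).2 (hc' t)⟩, by fun_prop⟩, ?_, ?_⟩⟩⟩
    · exact Subtype.ext (congrArg (T.toSmoothTube.pt hK) c0)
    · exact Subtype.ext (congrArg (T.toSmoothTube.pt hK) hcq)
  · intro p p' γ
    -- paths in the unit shell are pushed out to radius 1
    have key : ∀ p : T.boundary, ∀ q, T.toSmoothTube.pt hK q = ι p → q.radius⁻¹ = 1 := by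
      rintro ⟨_, b, rfl⟩ q hq
      rw [(T.toSmoothTube.isEmbedding_pt hK).injective (hq.trans (T.inclusion_torusMap hK b)),
        Tube.radius_toPunctured, inv_one]
    obtain ⟨γ', hh, hγ'⟩ := T.toSmoothTube.exists_homotopic_rescale hK
      (PeripheralSystem.PathPair.incl γ) (fun t => SmoothTube.shell_subset_range _ hK 1 (γ t).2)
      (f := fun ρ => ρ⁻¹) (continuousOn_id.inv₀ fun x hx => ne_of_gt hx)
      (fun ρ hρ => inv_pos.2 hρ) (key p) (key p')
    have hm : ∀ t, ∃ q, T.toSmoothTube.pt hK q = γ' t ∧ q.radius = 1 := by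
      intro t
      obtain ⟨q, hq, q', -, e⟩ := hγ' t
      exact ⟨q, hq, e.trans (mul_inv_cancel₀ q'.radius_pos.ne')⟩
    have hρ : ∀ t, ι (ρ (γ' t)) = γ' t := by
      intro t
      obtain ⟨q, hq, hr⟩ := hm t
      rw [← hq]
      exact SmoothTube.push_pt_of_le _ hK hr.ge
    have hb : ∀ t, ρ (γ' t) ∈ T.boundary := by
      intro t
      obtain ⟨q, hq, hr⟩ := hm t
      exact T.inclusion_mem_boundary hK _ q hr (hq.trans (hρ t).symm)
    refine ⟨⟨⟨fun t => ⟨ρ (γ' t), hb t⟩, by fun_prop⟩, ?_, ?_⟩, ?_⟩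
    · exact Subtype.ext ((congrArg ρ γ'.source).trans (T.retraction_inclusion hK p))
    · exact Subtype.ext ((congrArg ρ γ'.target).trans (T.retraction_inclusion hK p'))
    · exact (Path.Homotopic.of_apply_eq hρ).trans hh

/-! ### Meridians of two tubes with the same core -/

/-- A real linear map of the complex plane with positive determinant has a dominant complex linear
part. -/
theorem exists_conj_decomposition (b₁ b₂ : ℂ) (h : 0 < b₁.re * b₂.im - b₁.im * b₂.re) :
    ∃ α β : ℂ, ‖β‖ < ‖α‖ ∧ ∀ z : ℂ, z.re • b₁ + z.im • b₂ = α * z + β * conj z := by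
  refine ⟨(b₁ - Complex.I * b₂) / 2, (b₁ + Complex.I * b₂) / 2, ?_, fun z => ?_⟩
  · refine lt_of_pow_lt_pow_left₀ 2 (norm_nonneg _) ?_
    rw [← Complex.normSq_eq_norm_sq, ← Complex.normSq_eq_norm_sq]
    simp [Complex.normSq_apply]
    nlinarith
  · apply Complex.ext <;> simp <;> ring

namespace SmoothTube

open PuncturedTube

variable {n m : ℕ} (S : SmoothTube n) (S' : SmoothTube m)

/-- In the coordinates of one tube, a fibre of another tube with the same oriented core is tangent
to a real linear map of the complex plane, which has positive determinant by the orientation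
conditions. -/
theorem exists_linear_approximation {i : Fin n} {u : Circle} {j : Fin m} {v : Circle}
    (h : S.map i u 0 = S'.map j v 0) {r : ℝ} (hr : 0 < r)
    (hd : S.dCircle i u 0 = r • S'.dCircle j v 0) :
    ∃ α β : ℂ, ‖β‖ < ‖α‖ ∧ ∀ δ : ℝ, 0 < δ → ∀ᶠ z in 𝓝 (0 : ℂ), ∃ v' ζ,
      S.map i u z = S'.map j v' ζ ∧ ‖ζ - (α * z + β * conj z)‖ ≤ δ * ‖z‖ := by
  have hS' := S'.hasStrictFDerivAt_cone_equiv j v 0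
  let g := hS'.localInverse
  have e0 : S'.cone j v (0, 0, 1) = (S.map i u 0 : E4) := by simp [cone, h]
  have e1 : S.cone i u (0, 0, 1) = (S.map i u 0 : E4) := by simp [cone]
  have hgd : HasFDerivAt g ((S'.fderivCone j v 0).symm : E4 →L[ℝ] ℝ × ℂ × ℝ)
      (S.cone i u (0, (0 : ℂ), 1)) := by
    have := hS'.to_localInverse.hasFDerivAt
    rwa [e0, ← e1] at this
  let ψ : ℂ → ℝ × ℂ × ℝ := fun z => g (S.cone i u (0, z, 1))
  let A : ℂ →L[ℝ] ℝ × ℂ × ℝ :=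
    ContinuousLinearMap.prod 0 (ContinuousLinearMap.prod (.id ℝ ℂ) 0)
  let B : ℂ →L[ℝ] ℝ × ℂ × ℝ := ((S'.fderivCone j v 0).symm : E4 →L[ℝ] ℝ × ℂ × ℝ).comp
    ((S.fderivCone i u 0 : (ℝ × ℂ × ℝ) →L[ℝ] E4).comp A)
  have hψ : HasFDerivAt ψ B 0 := by
    have hA : HasFDerivAt (fun z : ℂ => ((0, z, 1) : ℝ × ℂ × ℝ)) A 0 :=
      (hasFDerivAt_const _ _).prodMk ((hasFDerivAt_id _).prodMk (hasFDerivAt_const _ _))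
    exact hgd.comp (0 : ℂ) (HasFDerivAt.comp (g := S.cone i u) (0 : ℂ)
      (S.hasStrictFDerivAt_cone_equiv i u 0).hasFDerivAt hA)
  -- `B` is the derivative of the fibre in the coordinates of the second tube; the two core
  -- directions differ by the factor `r > 0`, so its middle component has positive determinant
  have hB : ∀ b : ℂ, (B b).1 • S'.dCircle j v 0 + (B b).2.1.re • S'.dRe j v 0 +
      (B b).2.1.im • S'.dIm j v 0 + (B b).2.2 • (S.map i u 0 : E4) =
        b.re • S.dRe i u 0 + b.im • S.dIm i u 0 := by
    intro b
    have h1 := S'.fderiv_cone_apply j v 0 (B b).1 (B b).2.1 (B b).2.2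
    have h2 := S.fderiv_cone_apply i u 0 0 b 0
    have h3 : fderiv ℝ (S'.cone j v) (0, 0, 1) (B b) = fderiv ℝ (S.cone i u) (0, 0, 1) (0, b, 0) :=
      (S'.fderivCone j v 0).apply_symm_apply _
    rw [h, ← h1, h3, h2]
    simp
  have hdet : 0 < (B 1).2.1.re * (B Complex.I).2.1.im - (B 1).2.1.im * (B Complex.I).2.1.re := by
    have h1 := S.positive i u 0
    have h2 := S'.positive j v 0
    have hRe := hB 1
    have hIm := hB Complex.I
    simp only [Complex.one_re, Complex.one_im, Complex.I_re, Complex.I_im, one_smul, zero_smul,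
      add_zero, zero_add] at hRe hIm
    change 0 < det4 _ (S.dCircle i u 0) (S.dRe i u 0) (S.dIm i u 0) at h1
    rw [← hRe, ← hIm, hd, det4_combination, h] at h1
    have h3 := pos_of_mul_pos_left h1 h2.le
    exact pos_of_mul_pos_right h3 hr.le
  obtain ⟨α, β, hαβ, hlin⟩ := exists_conj_decomposition _ _ hdet
  refine ⟨α, β, hαβ, fun δ hδ => ?_⟩
  have hB2 : ∀ z, (B z).2.1 = α * z + β * conj z := by
    intro z
    have : z = z.re • (1 : ℂ) + z.im • Complex.I := by simp [Complex.re_add_im]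
    rw [← hlin z]
    conv_lhs => rw [this]
    simp only [map_add, map_smul, Prod.snd_add, Prod.fst_add, Prod.smul_snd, Prod.smul_fst]
  have hψ0 : ψ 0 = (0, 0, 1) := by
    change g (S.cone i u (0, 0, 1)) = _
    rw [e1, ← e0]
    exact hS'.localInverse_apply_image
  have ev1 : ∀ᶠ z in 𝓝 (0 : ℂ), S'.cone j v (ψ z) = S.cone i u (0, z, 1) := by
    have h1 := hS'.eventually_right_inverse
    rw [e0, ← e1] at h1
    have hc : ContinuousAt (fun z : ℂ => S.cone i u (0, z, 1)) 0 :=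
      ((S.contDiff_cone i u).continuous.comp (by fun_prop)).continuousAt
    exact hc.eventually h1
  have ev2 : ∀ᶠ z in 𝓝 (0 : ℂ), 0 < (ψ z).2.2 := by
    have hc : ContinuousAt (fun z => (ψ z).2.2) 0 := hψ.continuousAt.snd.snd
    exact hc.eventually_const_lt (by simp only [hψ0]; exact one_pos)
  have ev3 : ∀ᶠ z in 𝓝 (0 : ℂ), ‖ψ z - ψ 0 - B (z - 0)‖ ≤ δ * ‖z - 0‖ :=
    hψ.isLittleO.def hδ
  filter_upwards [ev1, ev2, ev3] with z h1 h2 h3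
  refine ⟨v * Circle.exp (ψ z).1, (ψ z).2.1, (S3.eq_of_smul_eq h2.le ?_).symm, ?_⟩
  · rw [show S.cone i u (0, z, 1) = (S.map i u z : E4) by simp [cone]] at h1
    exact h1
  · rw [sub_zero, hψ0] at h3
    rw [← hB2]
    refine le_trans ?_ h3
    refine le_trans (le_of_eq ?_) ((norm_fst_le _).trans (norm_snd_le (ψ z - (0, 0, 1) - B z)))
    simp

variable {K : Set S3} (hK : S.core = K) (hK' : S'.core = K)

/-- Small meridians of two tubes around the same point of the core are homotopic: the fibre of the
first tube is deformed to its linearization, and from there to the complex linear part. -/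
theorem exists_radius_meridianAt_homotopic {i : Fin n} {u : Circle} {j : Fin m} {v : Circle}
    (h : S.map i u 0 = S'.map j v 0) {r : ℝ} (hr : 0 < r)
    (hd : S.dCircle i u 0 = r • S'.dCircle j v 0) :
    ∃ ε₀ > 0, ∀ q : PuncturedTube n, q.1.1 = i → q.1.2.1 = u → radius q < ε₀ →
      ∀ hx', (S.meridianAt hK (S.pt hK q) (mem_range_self q)).Homotopic
        (S'.meridianAt hK' (S.pt hK q) hx') := by
  obtain ⟨α, β, hαβ, hlin⟩ := S.exists_linear_approximation S' h hr hd
  have hκ : 0 < (‖α‖ - ‖β‖) / 2 := by linarith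
  obtain ⟨ε₀, hε₀, hball⟩ := Metric.eventually_nhds_iff_ball.1 (hlin _ hκ)
  refine ⟨ε₀, hε₀, ?_⟩
  rintro ⟨⟨i', u', z₀⟩, hz₀⟩ rfl rfl hq hx'
  -- `χ z` are the coordinates of the point `z` of the fibre in the second tube
  have : Nonempty (Fin m × Circle × ℂ) := ⟨(j, v, 0)⟩
  let e := S'.isOpenEmbedding_emb.toOpenPartialHomeomorph
  let χ : ℂ → Fin m × Circle × ℂ := fun z => e.symm (S.map i' u' z)
  have hχ : ∀ z ∈ Metric.ball (0 : ℂ) ε₀,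
      S'.emb (j, (χ z).2.1, (χ z).2.2) = S.map i' u' z ∧
      ‖(χ z).2.2 - (α * z + β * conj z)‖ ≤ (‖α‖ - ‖β‖) / 2 * ‖z‖ := by
    intro z hz
    obtain ⟨v', ζ, e1, e2⟩ := hball z hz
    have : χ z = (j, v', ζ) := by
      change e.symm (S.map i' u' z) = _
      rw [e1]
      exact e.left_inv (x := (j, v', ζ)) (by simp [e])
    rw [this]
    exact ⟨e1.symm, e2⟩
  have hχc : ContinuousOn χ (Metric.ball 0 ε₀) := by
    refine e.continuousOn_symm.comp ?_ ?_
    · exact (S.continuous_emb.comp (f := fun z : ℂ => (i', u', z)) (by fun_prop)).continuousOn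
    · intro z hz
      obtain ⟨v', ζ, e1, -⟩ := hball z hz
      simp only [e, IsOpenEmbedding.toOpenPartialHomeomorph_target]
      exact ⟨(j, v', ζ), e1.symm⟩
  change ‖z₀‖ < ε₀ at hq
  let ζ : I → ℂ := fun τ => z₀ * Circle.exp (2 * Real.pi * τ)
  have hζc : Continuous ζ := by fun_prop
  have hζn : ∀ τ, ‖ζ τ‖ = ‖z₀‖ := fun τ => by
    simp only [ζ]; rw [norm_mul, Circle.norm_coe, _root_.mul_one]
  have hmem : ∀ p : I × I, ((1 - p.1 : ℝ) : ℂ) * ζ p.2 ∈ Metric.ball (0 : ℂ) ε₀ := by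
    intro p
    rw [mem_ball_zero_iff, norm_mul, hζn, Complex.norm_real,
      Real.norm_of_nonneg (by linarith [p.1.2.2])]
    refine lt_of_le_of_lt (mul_le_of_le_one_left (norm_nonneg _) ?_) hq
    linarith [p.1.2.1]
  have hmem' : ∀ τ, ζ τ ∈ Metric.ball (0 : ℂ) ε₀ := fun τ => by
    rw [mem_ball_zero_iff, hζn]; exact hq
  -- the linear homotopy from the fibre to the linear map `z ↦ α z`
  let f : I × I → ℂ := fun p =>
    ((1 - p.1 : ℝ) : ℂ) * (χ (ζ p.2)).2.2 + ((p.1 : ℝ) : ℂ) * (α * ζ p.2)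
  -- a zero would give `|α z| ≤ |α z + β z̄ - χ(z)| + |β z|`, against the choice of `ε₀`
  have hf : ∀ p, f p ≠ 0 := by
    intro p hp
    have h1 := (hχ _ (hmem' p.2)).2
    have ht0 : 0 ≤ (1 - p.1 : ℝ) := by linarith [p.1.2.2]
    have ht1 : (1 - p.1 : ℝ) ≤ 1 := by linarith [p.1.2.1]
    have e1 : α * ζ p.2 = -(((1 - p.1 : ℝ) : ℂ) * (((χ (ζ p.2)).2.2 -
        (α * ζ p.2 + β * conj (ζ p.2))) + β * conj (ζ p.2))) := by
      have : f p = ((1 - p.1 : ℝ) : ℂ) * (χ (ζ p.2)).2.2 + ((p.1 : ℝ) : ℂ) * (α * ζ p.2) := rfl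
      rw [hp] at this
      push_cast at this ⊢
      linear_combination -this
    have e2 := congrArg norm e1
    rw [norm_neg, norm_mul, hζn, norm_mul, Complex.norm_real, Real.norm_of_nonneg ht0] at e2
    have e3 := norm_add_le ((χ (ζ p.2)).2.2 - (α * ζ p.2 + β * conj (ζ p.2))) (β * conj (ζ p.2))
    rw [norm_mul, Complex.norm_conj, hζn] at e3
    rw [hζn] at h1
    have hz : 0 < ‖z₀‖ := norm_pos_iff.2 hz₀
    have e4 := mul_le_of_le_one_left (norm_nonneg ((χ (ζ p.2)).2.2 -
      (α * ζ p.2 + β * conj (ζ p.2)) + β * conj (ζ p.2))) ht1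
    nlinarith
  have hχζ : Continuous fun p : I × I => χ (ζ p.2) :=
    hχc.comp_continuous (by fun_prop) fun p => hmem' p.2
  have hχζ' : Continuous fun p : I × I => χ (((1 - p.1 : ℝ) : ℂ) * ζ p.2) :=
    hχc.comp_continuous (by fun_prop) hmem
  have hfc : Continuous f := by
    have h1 : Continuous fun p : I × I => (χ (ζ p.2)).2.2 := hχζ.snd.snd
    have h2 : Continuous fun p : I × I => ((1 - p.1 : ℝ) : ℂ) := by fun_prop
    exact (h2.mul h1).add (by fun_prop)
  -- in the circle coordinate the fibre is contracted to the point of the core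
  let c : C(I × I, PuncturedTube m) :=
    ⟨fun p => ⟨(j, (χ (((1 - p.1 : ℝ) : ℂ) * ζ p.2)).2.1, f p), hf p⟩,
      (continuous_const.prodMk (hχζ'.snd.fst.prodMk hfc)).subtype_mk _⟩
  have hζ0 : ζ 0 = z₀ := by simp [ζ]
  have hζ1 : ζ 1 = z₀ := by simp [ζ]
  have hc0 : ∀ τ, S'.pt hK' (c (0, τ)) =
      S.meridianAt hK (S.pt hK ⟨(i', u', z₀), hz₀⟩) (mem_range_self _) τ := by
    intro τ
    rw [S.meridianAt_eq hK _ rfl]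
    refine Subtype.ext ?_
    change S'.emb (j, (χ (((1 - (0 : I) : ℝ) : ℂ) * ζ τ)).2.1, f (0, τ)) = S.map i' u' (ζ τ)
    rw [← (hχ _ (hmem' τ)).1]
    simp [f]
  have hc1 : ∀ τ, S'.pt hK' (c (1, τ)) =
      S'.meridianAt hK' (S'.pt hK' (c (1, 0))) (mem_range_self _) τ := by
    intro τ
    rw [S'.meridianAt_eq hK' _ rfl]
    refine congrArg _ (Subtype.ext (Prod.ext rfl (Prod.ext ?_ ?_)))
    · simp [c, mul]
    · simp [c, mul, f, ζ, mul_assoc]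
  have hcc : ∀ t, c (t, 1) = c (t, 0) := by
    intro t
    simp [c, f, hζ0, hζ1]
  let γ : Path (S.pt hK ⟨(i', u', z₀), hz₀⟩) (S'.pt hK' (c (1, 0))) :=
    ⟨⟨fun t => S'.pt hK' (c (t, 0)), by fun_prop⟩, (hc0 0).trans (Path.source _), rfl⟩
  have k1 := PeripheralSystem.square ⟨fun p : I × I => S'.pt hK' (c p), by fun_prop⟩
    (S.meridianAt hK (S.pt hK ⟨(i', u', z₀), hz₀⟩) (mem_range_self _))
    (S'.meridianAt hK' (S'.pt hK' (c (1, 0))) (mem_range_self _)) γ γ hc0 hc1 (fun _ => rfl)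
    (fun t => congrArg (S'.pt hK') (hcc t))
  have k2 := S'.meridianAt_conj hK' ⟨fun t => c (t, 0), by fun_prop⟩ γ (fun _ => rfl) hx'
    (mem_range_self _)
  exact Path.Homotopic.of_trans_right_cancel (k1.trans k2.symm)

/-- Two tubes with the same oriented core have homotopic meridians, as far as a shell of one of
them is contained in the other one. -/
theorem meridianAt_homotopic
    (hS : SameOriented (fun i u => S.map i u 0) (fun j v => S'.map j v 0)) {s : ℝ}
    (hs : S.shell hK s ⊆ range (S'.pt hK')) (x : ↥Kᶜ) (hx : x ∈ range (S.pt hK))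
    (hx' : x ∈ range (S'.pt hK')) (hxs : x ∈ S.shell hK s) :
    (S.meridianAt hK x hx).Homotopic (S'.meridianAt hK' x hx') := by
  obtain ⟨q, hq, rfl⟩ := hxs
  obtain ⟨j, v, h, r, hr, hd⟩ := hS.1 q.1.1 q.1.2.1
  obtain ⟨ε₀, hε₀, H⟩ := S.exists_radius_meridianAt_homotopic S' hK hK' h hr hd
  have h0 := radius_pos q
  have ha : 0 < min 1 (ε₀ / 2 / radius q) := lt_min one_pos (by positivity)
  -- the meridians are conjugate to those at a point close to the core, along the same path
  obtain ⟨c, c0, c1, hc⟩ := exists_radial_path q ha (min_le_left _ _)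
  have hsmall : radius (c 1) < ε₀ := by
    rw [c1, radius_mul, Complex.norm_real, Real.norm_of_nonneg ha.le]
    calc _ ≤ radius q * (ε₀ / 2 / radius q) :=
          mul_le_mul_of_nonneg_left (min_le_right _ _) h0.le
      _ = ε₀ / 2 := mul_div_cancel₀ _ h0.ne'
      _ < ε₀ := half_lt_self hε₀
  have hr' : ∀ t, S.pt hK (c t) ∈ range (S'.pt hK') := fun t =>
    hs ((S.pt_mem_shell hK).2 ((hc t).trans hq))
  let γ : Path (S.pt hK q) (S.pt hK (c 1)) :=
    ⟨⟨fun t => S.pt hK (c t), by fun_prop⟩, congrArg (S.pt hK) c0, rfl⟩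
  have k1 := S.meridianAt_conj hK c γ (fun _ => rfl) hx (mem_range_self _)
  have k2 := S'.meridianAt_conj hK' ⟨fun t => S'.coord hK' ⟨S.pt hK (c t), hr' t⟩, by fun_prop⟩ γ
    (fun t => S'.pt_coord hK' _) hx' (hr' 1)
  have k3 := H (c 1) (by rw [c1]; rfl) (by rw [c1]; rfl) hsmall (hr' 1)
  exact Path.Homotopic.of_trans_right_cancel
    (k1.trans (((Path.Homotopic.refl γ).hcomp k3).trans k2.symm))

end SmoothTube

/-! ### The link complement is path connected -/

namespace SmoothTube

open PuncturedTube

variable {n m : ℕ} (S : SmoothTube n) (S' : SmoothTube m) {K : Set S3}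

theorem contDiff_core_curve (i : Fin n) :
    ContDiff ℝ ∞ fun θ : ℝ => (S.map i (Circle.exp θ) 0 : E4) := by
  have h : ContDiff ℝ ∞ fun θ : ℝ => ((θ, 0, 1) : ℝ × ℂ × ℝ) :=
    contDiff_id.prodMk (contDiff_const.prodMk contDiff_const)
  simpa [cone, Function.comp_def] using (S.contDiff_cone i 1).comp h

/-- The union of the lines through `x` that meet the linear cone on the core, or the origin. -/
def shadow (x : E4) : Set E4 :=
  (⋃ i, range fun p : ℝ × ℝ × ℝ => x + p.1 • (p.2.1 • (S.map i (Circle.exp p.2.2) 0 : E4) - x)) ∪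
    range fun s : ℝ => x - s • x

theorem dimH_shadow_lt (x : E4) : dimH (S.shadow x) < 4 := by
  have h3 : dimH (S.shadow x) ≤ 3 := by
    rw [shadow, dimH_union, dimH_iUnion]
    refine max_le (iSup_le fun i => ?_) ?_
    · have hc := (S.contDiff_core_curve i).of_le (m := 1) (by simp)
      have : ContDiff ℝ 1 fun p : ℝ × ℝ × ℝ =>
          x + p.1 • (p.2.1 • (S.map i (Circle.exp p.2.2) 0 : E4) - x) :=
        contDiff_const.add (contDiff_fst.smul ((contDiff_snd.fst.smul
          (hc.comp contDiff_snd.snd)).sub contDiff_const))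
      refine this.dimH_range_le.trans ?_
      norm_num
    · have : ContDiff ℝ 1 fun s : ℝ => x - s • x :=
        contDiff_const.sub (contDiff_id.smul contDiff_const)
      refine this.dimH_range_le.trans ?_
      norm_num
  exact h3.trans_lt (by norm_num)

/-- A segment from a point `x` of the link complement to a point outside the shadow of the link as
seen from `x` avoids the cone on the link. -/
theorem joinedIn_of_notMem_shadow (hK : S.core = K) (x : ↥Kᶜ) {p : E4} (hp : p ∉ S.shadow (x : S3)) :
    JoinedIn {v : E4 | v ≠ 0 ∧ ∀ y ∈ S.core, ∀ t : ℝ, 0 ≤ t → v ≠ t • (y : E4)} (x : S3) p := by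
  refine JoinedIn.of_segment_subset ?_
  rw [segment_eq_image']
  rintro _ ⟨τ, ⟨h0, -⟩, rfl⟩
  have key : ∀ v : E4, ((x : S3) : E4) + τ • (p - (x : S3)) = v → τ ≠ 0 →
      p = ((x : S3) : E4) + τ⁻¹ • (v - (x : S3)) := by
    rintro v rfl hτ
    rw [add_sub_cancel_left, smul_smul, inv_mul_cancel₀ hτ, one_smul, add_sub_cancel]
  refine ⟨fun h => ?_, ?_⟩
  · rcases eq_or_ne τ 0 with rfl | hτ
    · have h1 := S3.norm_coe (x : S3)
      simp only [zero_smul, add_zero] at h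
      rw [h, norm_zero] at h1
      exact zero_ne_one h1
    · refine hp (Or.inr ⟨τ⁻¹, ?_⟩)
      rw [key _ h hτ, zero_sub, smul_neg]
      exact sub_eq_add_neg _ _
  · rintro _ ⟨i, u, rfl⟩ t ht h
    rcases eq_or_ne τ 0 with rfl | hτ
    · simp only [zero_smul, add_zero] at h
      exact x.2 (hK.subset ⟨i, u, S3.eq_of_smul_eq ht h.symm⟩)
    · obtain ⟨θ, rfl⟩ := Circle.exp_surjective u
      exact hp (Or.inl (mem_iUnion.2 ⟨i, (τ⁻¹, t, θ), (key _ h hτ).symm⟩))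

/-- The shadows of the link as seen from two points have dimension at most 3, so some point of `ℝ⁴`
lies outside both. -/
theorem joined_compl (hK : S.core = K) (x y : ↥Kᶜ) : Joined x y := by
  have hd : dimH (S.shadow (x : S3) ∪ S.shadow (y : S3)) < Module.finrank ℝ E4 := by
    rw [dimH_union, finrank_euclideanSpace_fin]
    exact max_lt (S.dimH_shadow_lt _) (S.dimH_shadow_lt _)
  obtain ⟨p, hp⟩ := (dense_compl_of_dimH_lt_finrank hd).nonempty
  rw [mem_compl_iff, mem_union, not_or] at hp
  obtain ⟨γ, hγ⟩ := (S.joinedIn_of_notMem_shadow hK x hp.1).trans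
    (S.joinedIn_of_notMem_shadow hK y hp.2).symm
  have hn : ∀ t, 0 < ‖γ t‖ := fun t => norm_pos_iff.2 (hγ t).1
  let f : I → S3 := fun t => ⟨‖γ t‖⁻¹ • γ t, by
    rw [mem_sphere_zero_iff_norm, norm_smul, norm_inv, norm_norm, inv_mul_cancel₀ (hn t).ne']⟩
  have hf : Continuous f :=
    ((Continuous.inv₀ (by fun_prop) fun t => (hn t).ne').smul γ.continuous).subtype_mk _
  have hfK : ∀ t, f t ∈ Kᶜ := by
    intro t ht
    refine (hγ t).2 (f t) (hK ▸ ht) ‖γ t‖ (hn t).le ?_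
    change γ t = ‖γ t‖ • ‖γ t‖⁻¹ • γ t
    rw [smul_smul, mul_inv_cancel₀ (hn t).ne', one_smul]
  refine ⟨⟨⟨fun t => ⟨f t, hfK t⟩, hf.subtype_mk _⟩, ?_, ?_⟩⟩
  · refine Subtype.ext (Subtype.ext ?_)
    change ‖γ 0‖⁻¹ • γ 0 = _
    rw [γ.source, S3.norm_coe, inv_one, one_smul]
  · refine Subtype.ext (Subtype.ext ?_)
    change ‖γ 1‖⁻¹ • γ 1 = _
    rw [γ.target, S3.norm_coe, inv_one, one_smul]

/-! ### Independence of the tube -/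

variable (hK : S.core = K) (hK' : S'.core = K)

/-- A thin shell of one tube is contained in a given shell of another tube with the same core. -/
theorem exists_shell_subset {r : ℝ} (hr : 0 < r) : ∃ s > 0, S.shell hK s ⊆ S'.shell hK' r := by
  have hU : IsOpen (S'.emb '' {q | ‖q.2.2‖ < r}) :=
    S'.isOpenEmbedding_emb.isOpenMap _ (isOpen_lt (by fun_prop) continuous_const)
  have hev : ∀ᶠ z in 𝓝 (0 : ℂ), ∀ p ∈ (univ : Set (Fin n × Circle)),
      S.emb (p.1, p.2, z) ∈ S'.emb '' {q | ‖q.2.2‖ < r} := by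
    refine isCompact_univ.eventually_forall_of_forall_eventually fun p _ => ?_
    have hc : Continuous fun w : ℂ × Fin n × Circle => S.emb (w.2.1, w.2.2, w.1) :=
      S.continuous_emb.comp (by fun_prop)
    refine hc.continuousAt.eventually_mem (hU.mem_nhds ?_)
    have : S.emb (p.1, p.2, 0) ∈ S'.core := by
      rw [hK', ← hK]; exact ⟨p.1, p.2, rfl⟩
    obtain ⟨j, v, h⟩ := this
    exact ⟨(j, v, 0), by simpa using hr, h⟩
  obtain ⟨ε, hε, H⟩ := Metric.eventually_nhds_iff_ball.1 hev
  refine ⟨ε / 2, half_pos hε, ?_⟩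
  rintro _ ⟨q, hq, rfl⟩
  obtain ⟨q', hq', e⟩ := H q.1.2.2
    (mem_ball_zero_iff.2 (lt_of_le_of_lt hq (half_lt_self hε))) (q.1.1, q.1.2.1) (mem_univ _)
  obtain ⟨w, hw⟩ := (S'.mem_range_pt hK' (S.pt hK q)).2 ⟨q', e⟩
  refine ⟨w, ?_, hw⟩
  have : w.1 = q' := S'.injective ((congrArg Subtype.val hw).trans e.symm)
  change ‖w.1.2.2‖ ≤ r
  rw [this]
  exact le_of_lt hq'

/-- The peripheral systems of any two tubes with the same oriented core, and with any basepoints,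
have isomorphic biquandles. -/
theorem nonempty_iso_of_sameOriented
    (hS : SameOriented (fun i u => S.map i u 0) (fun j v => S'.map j v 0)) (z₀ z₁ w₀ w₁ : ↥Kᶜ) :
    Nonempty (BiquandleIso (S.system hK 1 z₀ z₁).Classes (S'.system hK' 1 w₀ w₁).Classes) := by
  -- nested shells: the second tube in radius `r ≤ 1` lies in the first one, and contains it in
  -- radius `s ≤ 1`, which in turn contains the second one in radius `s'`
  obtain ⟨r, hr, h₂⟩ := S'.exists_shell_subset S hK' hK one_pos
  have h₂' : S'.shell hK' (min r 1) ⊆ range (S.pt hK) := fun x ⟨q, hq, e⟩ =>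
    S.shell_subset_range hK 1 (h₂ ⟨q, hq.trans (min_le_left _ _), e⟩)
  have hr' : 0 < min r 1 := lt_min hr one_pos
  obtain ⟨s, hs, h₁⟩ := S.exists_shell_subset S' hK hK' hr'
  have h₁' : S.shell hK (min s 1) ⊆ S'.shell hK' (min r 1) := fun x ⟨q, hq, e⟩ =>
    h₁ ⟨q, hq.trans (min_le_left _ _), e⟩
  have hs' : 0 < min s 1 := lt_min hs one_pos
  obtain ⟨s', hs'', h₃⟩ := S'.exists_shell_subset S hK' hK hs'
  obtain ⟨δ₀⟩ := S.joined_compl hK z₀ w₀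
  obtain ⟨δ₁⟩ := S.joined_compl hK z₁ w₁
  obtain ⟨e₁⟩ := S.nonempty_iso_radius hK hs' (min_le_right s 1) z₀ z₁
  obtain ⟨e₂⟩ := S.nonempty_iso_of_interleaved S' hK hK' hs' hs'' h₁' h₂' h₃
    (S.meridianAt_homotopic S' hK hK' hS (h₁'.trans (S'.shell_subset_range hK' _))) δ₀ δ₁
  obtain ⟨e₃⟩ := S'.nonempty_iso_radius hK' hr' (min_le_right r 1) w₀ w₁
  exact ⟨(e₁.symm.trans e₂).trans e₃⟩

end SmoothTube

/-! ### Oriented curves and diffeomorphisms -/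

theorem SameOriented.trans {k n m : ℕ} {c : Fin k → Circle → S3} {d : Fin n → Circle → S3}
    {e : Fin m → Circle → S3} (h : SameOriented c d) (h' : SameOriented d e) :
    SameOriented c e := by
  refine ⟨fun i u => ?_, fun l w => ?_⟩
  · obtain ⟨j, v, e1, r, hr, e2⟩ := h.1 i u
    obtain ⟨l, w, e3, s, hs, e4⟩ := h'.1 j v
    exact ⟨l, w, e1.trans e3, r * s, mul_pos hr hs, by rw [e2, e4, smul_smul]⟩
  · obtain ⟨j, v, e1⟩ := h'.2 l w
    obtain ⟨i, u, e2⟩ := h.2 j v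
    exact ⟨i, u, e2.trans e1⟩

theorem SameOriented.symm {n m : ℕ} {c : Fin n → Circle → S3} {d : Fin m → Circle → S3}
    (h : SameOriented c d) (hd : Function.Injective fun p : Fin m × Circle => d p.1 p.2) :
    SameOriented d c := by
  refine ⟨fun j w => ?_, fun i u => ?_⟩
  · obtain ⟨i, u, e⟩ := h.2 j w
    obtain ⟨j', w', e', r, hr, hv⟩ := h.1 i u
    have := hd (a₁ := (j', w')) (a₂ := (j, w)) (e'.symm.trans e)
    obtain ⟨rfl, rfl⟩ := Prod.mk.inj this
    exact ⟨i, u, e.symm, r⁻¹, inv_pos.2 hr, by rw [hv, smul_smul, inv_mul_cancel₀ hr.ne', one_smul]⟩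
  · obtain ⟨j, w, e, -⟩ := h.1 i u
    exact ⟨j, w, e.symm⟩

theorem tangentToE4_injective (x : S3) : Function.Injective (tangentToE4 x) :=
  haveI : Fact (Module.finrank ℝ E4 = 3 + 1) := ⟨finrank_euclideanSpace_fin⟩
  injective_mvfderiv_subtypeVal_sphere (n := 3) x

theorem tangentToE4_smul (x : S3) (r : ℝ) (ξ : TangentSpace (𝓡 3) x) :
    tangentToE4 x (r • ξ) = r • tangentToE4 x ξ :=
  map_smul (mfderiv (𝓡 3) 𝓘(ℝ, E4) (fun y : S3 => (y : E4)) x) r ξ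

theorem tangentToE4_mfderiv_curve {c : ℝ → S3} (hc : MDifferentiableAt 𝓘(ℝ, ℝ) (𝓡 3) c 0) :
    tangentToE4 (c 0) (mfderiv 𝓘(ℝ, ℝ) (𝓡 3) c 0 (1 : ℝ)) = deriv (fun t => (c t : E4)) 0 := by
  have h1 : MDifferentiableAt (𝓡 3) 𝓘(ℝ, E4) (fun y : S3 => (y : E4)) (c 0) :=
    (contMDiff_coe_S3 (c 0)).mdifferentiableAt (by simp)
  have h2 := mfderiv_comp (0 : ℝ) h1 hc
  rw [mfderiv_eq_fderiv] at h2
  have h3 := congrArg (fun f : ℝ →L[ℝ] E4 => f 1) h2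
  exact h3.symm.trans fderiv_apply_one_eq_deriv

/-- The velocity vector of a curve in the sphere, as a tangent vector, and its image under a
diffeomorphism. -/
theorem exists_tangent_vector (h : Diffeomorph (𝓡 3) (𝓡 3) S3 S3 ∞) {c : ℝ → S3}
    (hc : MDifferentiableAt 𝓘(ℝ, ℝ) (𝓡 3) c 0) {x : S3} (hx : c 0 = x) :
    ∃ ξ : TangentSpace (𝓡 3) x, tangentToE4 x ξ = deriv (fun t => (c t : E4)) 0 ∧
      tangentToE4 (h x) (mfderiv (𝓡 3) (𝓡 3) h x ξ) = deriv (fun t => (h (c t) : E4)) 0 := by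
  subst hx
  refine ⟨mfderiv 𝓘(ℝ, ℝ) (𝓡 3) c 0 (1 : ℝ), tangentToE4_mfderiv_curve hc, ?_⟩
  have h1 : MDifferentiableAt (𝓡 3) (𝓡 3) h (c 0) :=
    (h.contMDiff (c 0)).mdifferentiableAt (by simp)
  have h2 := tangentToE4_mfderiv_curve (h1.comp (0 : ℝ) hc)
  rw [mfderiv_comp (0 : ℝ) h1 hc] at h2
  exact h2

theorem mdifferentiableAt_comp_circle {c : Circle → S3} (hc : ContMDiff (𝓡 1) (𝓡 3) ∞ c)
    (u : Circle) : MDifferentiableAt 𝓘(ℝ, ℝ) (𝓡 3) (fun t : ℝ => c (u * Circle.exp t)) 0 := by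
  have h1 : ContMDiff 𝓘(ℝ, ℝ) (𝓡 1) ∞ fun t : ℝ => u * Circle.exp t :=
    contMDiff_const.mul contMDiff_circleExp
  exact ((hc.comp h1) 0).mdifferentiableAt (by simp)

theorem SameOriented.map {n m : ℕ} {c : Fin n → Circle → S3} {d : Fin m → Circle → S3}
    (hcd : SameOriented c d) (hc : ∀ i, ContMDiff (𝓡 1) (𝓡 3) ∞ (c i))
    (hd : ∀ j, ContMDiff (𝓡 1) (𝓡 3) ∞ (d j)) (h : Diffeomorph (𝓡 3) (𝓡 3) S3 S3 ∞) :
    SameOriented (fun i u => h (c i u)) (fun j w => h (d j w)) := by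
  refine ⟨fun i u => ?_, fun j w => ?_⟩
  · obtain ⟨j, w, e, r, hr, hv⟩ := hcd.1 i u
    refine ⟨j, w, congrArg h e, r, hr, ?_⟩
    obtain ⟨ξ, h1, h2⟩ := exists_tangent_vector h (mdifferentiableAt_comp_circle (hc i) u)
      (x := c i u) (by simp)
    obtain ⟨η, h3, h4⟩ := exists_tangent_vector h (mdifferentiableAt_comp_circle (hd j) w)
      (x := c i u) (by simp [e])
    have : ξ = r • η := by
      apply tangentToE4_injective
      rw [tangentToE4_smul, h1, h3]
      exact hv
    change deriv _ _ = r • deriv _ _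
    rw [← h2, ← h4, this, map_smul, tangentToE4_smul]
  · obtain ⟨i, u, e⟩ := hcd.2 j w
    exact ⟨i, u, congrArg h e⟩

/-- The image of a tube under an orientation preserving diffeomorphism. -/
def SmoothTube.comp {n : ℕ} (S : SmoothTube n) (h : Diffeomorph (𝓡 3) (𝓡 3) S3 S3 ∞)
    (ho : IsOrientationPreserving h) : SmoothTube n where
  map i u z := h (S.map i u z)
  smooth i := h.contMDiff.comp (S.smooth i)
  injective := h.injective.comp S.injective
  positive i u z := by
    have hline : ∀ w : ℂ,
        MDifferentiableAt 𝓘(ℝ, ℝ) (𝓡 3) (fun t : ℝ => S.map i u (z + t * w)) 0 := by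
      intro w
      have h1 : ContMDiff 𝓘(ℝ, ℝ) 𝓘(ℝ, ℂ) ∞ fun t : ℝ => z + t * w :=
        (contDiff_const.add (Complex.ofRealCLM.contDiff.mul contDiff_const)).contMDiff
      exact (((S.smooth i).comp (contMDiff_const.prodMk h1)) 0).mdifferentiableAt (by simp)
    have hcirc :
        MDifferentiableAt 𝓘(ℝ, ℝ) (𝓡 3) (fun t : ℝ => S.map i (u * Circle.exp t) z) 0 :=
      mdifferentiableAt_comp_circle (c := fun u => S.map i u z)
        ((S.smooth i).comp (contMDiff_id.prodMk contMDiff_const)) u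
    obtain ⟨ξ₀, a₀, b₀⟩ := exists_tangent_vector h hcirc (x := S.map i u z) (by simp)
    obtain ⟨ξ₁, a₁, b₁⟩ := exists_tangent_vector h (hline 1) (x := S.map i u z) (by simp)
    obtain ⟨ξ₂, a₂, b₂⟩ := exists_tangent_vector h (hline Complex.I) (x := S.map i u z) (by simp)
    simp only [mul_one] at a₁ b₁
    have := ho (S.map i u z) ![ξ₀, ξ₁, ξ₂] (by
      change 0 < det4 _ (tangentToE4 _ ξ₀) (tangentToE4 _ ξ₁) (tangentToE4 _ ξ₂)
      rw [a₀, a₁, a₂]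
      exact S.positive i u z)
    change 0 < det4 _ (tangentToE4 _ (mfderiv (𝓡 3) (𝓡 3) h _ ξ₀))
      (tangentToE4 _ (mfderiv (𝓡 3) (𝓡 3) h _ ξ₁))
      (tangentToE4 _ (mfderiv (𝓡 3) (𝓡 3) h _ ξ₂)) at this
    rwa [b₀, b₁, b₂] at this

theorem SmoothTube.core_eq_of_sameOriented {n m : ℕ} (S : SmoothTube n) (S' : SmoothTube m)
    (hS : SameOriented (fun i u => S.map i u 0) (fun j v => S'.map j v 0)) : S.core = S'.core := by
  ext x
  constructor
  · rintro ⟨i, u, rfl⟩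
    obtain ⟨j, v, e, -⟩ := hS.1 i u
    exact ⟨j, v, e.symm⟩
  · rintro ⟨j, v, rfl⟩
    exact hS.2 j v

end

theorem mainTheorem4 (L L' : OrientedLink) (hLL' : L.SameType L')
    (D : L.Choices) (D' : L'.Choices) :
    Nonempty (BiquandleIso (TopologicalBiquandle L D) (TopologicalBiquandle L' D')) := by
  obtain ⟨h, ho, hh⟩ := hLL'
  let S := D.tube.toSmoothTube
  let S' := D'.tube.toSmoothTube
  have hsm : ∀ i, ContMDiff (𝓡 1) (𝓡 3) ∞ fun u => S.map i u 0 := fun i =>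
    (S.smooth i).comp (contMDiff_id.prodMk contMDiff_const)
  have hS : SameOriented (fun i u => (S.comp h ho).map i u 0) (fun j v => S'.map j v 0) :=
    ((D.tube.core.map hsm L.smooth h).trans hh).trans (D'.tube.core.symm L'.injective)
  have hK := (S.comp h ho).core_eq_of_sameOriented S' hS
  obtain ⟨z₀, z₁, ⟨e₁⟩⟩ := D.nonempty_iso_system rfl
  obtain ⟨w₀, w₁, ⟨e₂⟩⟩ := SmoothTube.nonempty_iso_of_homeomorph S (S.comp h ho) h.toHomeomorph
    (fun _ _ _ => rfl) rfl hK 1 z₀ z₁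
  obtain ⟨z₀', z₁', ⟨e₃⟩⟩ := D'.nonempty_iso_system rfl
  obtain ⟨e₄⟩ := (S.comp h ho).nonempty_iso_of_sameOriented S' hK rfl hS w₀ w₁ z₀' z₁'
  exact ⟨((e₁.trans e₂).trans e₄).trans e₃.symm⟩
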